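/- **Setting.** Let $\rho$ be a density operator and $O$ a Hermitian observable on $n$ qubits, and let $U(\vec\theta)=\prod_{l=1}^{M}V_l\,e^{-i\theta_{\mathcal S(l)}H_l}$ (the factor $l=1$ leftmost, $M\ge 1$) with fixed unitaries $V_l$, Hermitian generators $H_l$, parameters $\vec\theta\in\mathbb R^m$ and a surjection $\mathcal S:\{1,\dots,M\}\to\{1,\dots,m\}$. The loss is $\mathcal L(\vec\theta)=\mathrm{Tr}[U(\vec\theta)\rho U^\dagger(\vec\theta)O]$. Norms are operator norms. Write $O=\sum_i\lambda_i|\lambda_i\rangle\langle\lambda_i|$ with $\lambda_1\le\lambda_2\le\cdots$, $\Delta_{\rm gap}=\lambda_2-\lambda_1$, $\mathrm{Var}_\rho(H_M)=\mathrm{Tr}[\rho H_M^2]-\mathrm{Tr}[\rho H_M]^2$, $\omega_q=\sum_{l\in\mathcal S^{-1}(q)}(\lambda_{\max}(H_l)-\lambda_{\min}(H_l))$, and $p=\mathcal S(M)$, the parameter of the generator $H_M$ closest to the input state. $\mathrm{Var}_{r}$ denotes the variance for $\vec\theta$ uniform on the hypercube $\prod_i[\theta^*_i-r,\theta^*_i+r]$.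 **Assumptions.** $\vec\theta^*$ is a (local or global) minimum of $\mathcal L$; $\lambda_1<\lambda_2$; $\langle\lambda_1|U(\vec\theta^*)\rho U^\dagger(\vec\theta^*)|\lambda_1\rangle=1-|\epsilon|^2$; $\mathcal S(l)=p$ only for $l=M$; and $$|\epsilon|<T:=\frac{\Delta_{\rm gap}\mathrm{Var}_\rho(H_M)}{(6\|O\|+11\Delta_{\rm gap})\|H_M\|^2}.$$ **Patch.** Put $A=\Delta_{\rm gap}\mathrm{Var}_\rho(H_M)-|\epsilon|\,\|H_M\|^2(11\Delta_{\rm gap}+6\|O\|)$ and $$(r^*_{\rm patch})^2=\frac{9A^2}{128\,\|O\|^2\,\omega_p^4\,\max\{\sum_{j\ne p}\omega_j^2,\ \omega_p^2/2\}} .$$ **(1)** Then $A>0$, $r^*_{\rm patch}>0$, and for every $0<r\le r^*_{\rm patch}$, in particular for $r=r^*_{\rm patch}$, $$\mathrm{Var}_{r}[\mathcal L]\ \ge\ \frac{A^2}{18}\,r^4 .$$ **(2)** Consider a sequence of such problems, one for each number of qubits $n$ (the assumptions holding for all large $n$), with $\Delta_{\rm gap},\mathrm{Var}_\rho(H_M)\in\Omega(1/\mathrm{poly}(n))$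 and $\|O\|,\max_q\omega_q\in O(\mathrm{poly}(n))$. (a) There are $a>0$ and $k\in\mathbb N$ such that, if $m\in O(\mathrm{poly}(n))$, the patch of half-width $r_n=a/(\sqrt m\,n^k)$ around $\vec\theta^*$ has $\mathrm{Var}_{r_n}[\mathcal L]\in\Omega(1/(\sqrt m\,\mathrm{poly}(n)))$. (b) If moreover $|\epsilon|\le(1-\delta_n)T$ for some $\delta_n\in\Omega(1/\mathrm{poly}(n))$, then $r^*_{\rm patch}\in\Omega(1/(\sqrt m\,\mathrm{poly}(n)))$, and if $m\in O(\mathrm{poly}(n))$, then $\mathrm{Var}_{r^*_{\rm patch}}[\mathcal L]\in\Omega(1/(\sqrt m\,\mathrm{poly}(n)))$. -/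

import Mathlib

open Filter MeasureTheory ProbabilityTheory
open scoped Matrix Matrix.Norms.L2Operator ComplexOrder

noncomputable section

/-- Operators on `n` qubits: complex `2 ^ n × 2 ^ n` matrices. The norm `‖A‖` is the operator norm
(largest singular value). -/
abbrev QOp (n : ℕ) : Type := Matrix (Fin (2 ^ n)) (Fin (2 ^ n)) ℂ

/-- A variational problem on `n` qubits with `m` independent parameters and `M = K + 1` gates
(at least one gate): the parameter assignment `S`, the fixed unitaries `V l`, the Hermitian
generators `H l`, the input state `ρ` and the observable `O`. The gate with index `0` is closest to
the observable, the gate with index `Fin.last K` is closest to the input state. -/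
structure VarProblem (n m K : ℕ) where
  S : Fin (K + 1) → Fin m
  S_surj : Function.Surjective S
  V : Fin (K + 1) → Matrix.unitaryGroup (Fin (2 ^ n)) ℂ
  H : Fin (K + 1) → QOp n
  H_herm : ∀ l, (H l).IsHermitian
  ρ : QOp n
  ρ_psd : ρ.PosSemidef
  ρ_trace : ρ.trace = 1
  O : QOp n
  O_herm : O.IsHermitian

namespace VarProblem

variable {n m K : ℕ} (P : VarProblem n m K)

/-- The gate `V_l exp(-i t H_l)`. -/
def gate (l : Fin (K + 1)) (t : ℝ) : QOp n :=
  (P.V l : QOp n) * NormedSpace.exp ((-(Complex.I * (t : ℂ))) • P.H l)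

/-- The circuit `U(θ) = ∏_l V_l exp(-i θ_{S(l)} H_l)`, the factor `l = 0` standing leftmost. -/
def circuit (θ : Fin m → ℝ) : QOp n :=
  (List.ofFn fun l : Fin (K + 1) => P.gate l (θ (P.S l))).prod

/-- The evolved state `U(θ) ρ U(θ)†`. -/
def evolved (θ : Fin m → ℝ) : QOp n := P.circuit θ * P.ρ * (P.circuit θ)ᴴ

/-- The loss `Tr[U(θ) ρ U(θ)† O]`, which is a real number. -/
def loss (θ : Fin m → ℝ) : ℝ := (P.evolved θ * P.O).trace.re

/-- The generator closest to the input state. -/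
def lastH : QOp n := P.H (Fin.last K)

/-- The parameter of the generator closest to the input state. -/
def lastParam : Fin m := P.S (Fin.last K)

/-- `Var_ρ(H_M) = Tr[ρ H_M²] - Tr[ρ H_M]²`. -/
def stateVar : ℝ :=
  (P.ρ * (P.lastH * P.lastH)).trace.re - (P.ρ * P.lastH).trace.re ^ 2

/-- `λ_max(H_l) - λ_min(H_l)`. -/
def gateFreq (l : Fin (K + 1)) : ℝ :=
  (⨆ i, (P.H_herm l).eigenvalues i) - (⨅ i, (P.H_herm l).eigenvalues i)

/-- The maximal frequency of the parameter `q`: the sum of the maximal frequencies of the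
generators that carry this parameter. -/
def maxFreq (q : Fin m) : ℝ :=
  ∑ l ∈ Finset.univ.filter (fun l => P.S l = q), P.gateFreq l

/-- The variance of the loss for `θ` uniform on the hypercube of width `2 r` centred at `φ`. -/
def patchVar (φ : Fin m → ℝ) (r : ℝ) : ℝ :=
  variance P.loss
    (cond (volume : Measure (Fin m → ℝ)) (Set.Icc (fun i => φ i - r) (fun i => φ i + r)))

end VarProblem

/-- An eigendecomposition `O = ∑ i, lam i |v i⟩⟨v i|` with eigenvalues in increasing order. -/
structure EigenDecomp {n : ℕ} (O : QOp n) where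
  lam : Fin (2 ^ n) → ℝ
  lam_mono : Monotone lam
  v : OrthonormalBasis (Fin (2 ^ n)) ℂ (EuclideanSpace ℂ (Fin (2 ^ n)))
  eigen : ∀ i, Matrix.toEuclideanLin O (v i) = (lam i : ℂ) • v i

namespace EigenDecomp

variable {n : ℕ} {O : QOp n} (E : EigenDecomp O)

/-- The gap between the two lowest eigenvalues, counted with multiplicity. -/
def gap : ℝ := E.lam 1 - E.lam 0

/-- The rank one projection on the ground state. -/
def groundProj : QOp n := Matrix.vecMulVec (E.v 0).ofLp (star (E.v 0).ofLp)

end EigenDecomp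

namespace VarProblem

variable {n m K : ℕ} (P : VarProblem n m K)

/-- The bound that `|ε|` has to stay below. -/
def threshold (E : EigenDecomp P.O) : ℝ :=
  E.gap * P.stateVar / ((6 * ‖P.O‖ + 11 * E.gap) * ‖P.lastH‖ ^ 2)

/-- `Δ_gap Var_ρ(H_M) - |ε| ‖H_M‖² (11 Δ_gap + 6 ‖O‖)`. -/
def curv (E : EigenDecomp P.O) (ε : ℂ) : ℝ :=
  E.gap * P.stateVar - ‖ε‖ * ‖P.lastH‖ ^ 2 * (11 * E.gap + 6 * ‖P.O‖)

/-- The explicit half-width of the patch. -/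
def rStar (E : EigenDecomp P.O) (ε : ℂ) : ℝ :=
  √(9 * P.curv E ε ^ 2 /
    (128 * ‖P.O‖ ^ 2 * P.maxFreq P.lastParam ^ 4 *
      max (∑ j ∈ Finset.univ.erase P.lastParam, P.maxFreq j ^ 2)
        (P.maxFreq P.lastParam ^ 2 / 2)))

/-- The standing assumptions on a minimum `θ` of the loss. -/
structure GoodMinimum (E : EigenDecomp P.O) (θ : Fin m → ℝ) (ε : ℂ) : Prop where
  /-- `θ` is a minimum (possibly only a local one) of the loss. -/
  isMin : IsLocalMin P.loss θ
  /-- The ground state is non-degenerate. -/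
  nondeg : E.lam 0 < E.lam 1
  /-- The fidelity of the output state with the ground state is `1 - |ε|²`. -/
  fidelity : (P.evolved θ * E.groundProj).trace = ((1 - ‖ε‖ ^ 2 : ℝ) : ℂ)
  /-- The parameter of the last generator drives no other generator. -/
  uncorrelated : ∀ l, P.S l = P.lastParam → l = Fin.last K
  /-- The infidelity is small. -/
  small : ‖ε‖ < P.threshold E

end VarProblem

/-- `f ∈ O(poly(n))`, for nonnegative `f`. -/
def InOPoly (f : ℕ → ℝ) : Prop :=
  ∃ c : ℝ, 0 < c ∧ ∃ k : ℕ, ∀ᶠ n : ℕ in atTop, f n ≤ c * (n : ℝ) ^ k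

/-- `f ∈ Ω(1 / (g · poly(n)))`, for positive `g`. -/
def InOmegaInvPoly (g f : ℕ → ℝ) : Prop :=
  ∃ c : ℝ, 0 < c ∧ ∃ k : ℕ, ∀ᶠ n : ℕ in atTop, c / (g n * (n : ℝ) ^ k) ≤ f n

end

/-! Only the parameter p of the generator next to the input state is exploited. By Cauchy–Schwarz,
the variance is at least the squared correlation of the loss with w = (θ_p − θ*_p)² − r²/3, divided
by ∫ w² = 4r⁴/45 (`sq_integral_quadratic_mul_le`). Up to scale, w is the second Legendre polynomial;
under the uniform law it is orthogonal to every function of the other coordinates. Averaging over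
the reflection of θ_p about its centre removes the odd orders of the loss and leaves a term free of
θ_p, which w annihilates, half of t² times the second derivative F in direction p, and a quartic
remainder (`integral_quadratic_mul_ge`). Here F is taken at θ_p = θ*_p; reflecting the other
coordinates one at a time shows that its mean drops below F(θ*) by at most order r²
(`integral_piecewise_ge`).

The errors are controlled by frequencies: conjugation by exp(-itH) is generated by i[H, ·], whose
norm is at most the spread of H. Along coordinate j the pulled-back observable therefore obeys the
derivative bounds of a trigonometric polynomial of frequency ω_j (`hasBand_heis`). The half-width r*
makes both errors a small fraction of the curvature (`patchVar_ge`).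

The curvature F(θ*) is the expectation of a double commutator in the output state. In the exact
ground state P, with O shifted to have ground energy 0, it is 2 Tr[P H O H], and O ≥ gap · (1 − P)
bounds this below by 2 · gap · Var(H). Infidelity |ε|² costs errors linear in |ε|
(`trace_doubleCommutator_ge`, `lossCurv_ge`). The asymptotic claims follow by inserting polynomial
rates. -/

/-! ### Trace inequalities for density matrices, and the double commutator near a ground state. -/

namespace Matrix

variable {ι : Type*} [Fintype ι] [DecidableEq ι]

omit [DecidableEq ι] in
/-- The Cauchy-Schwarz inequality for the Frobenius inner product. -/
theorem norm_trace_conjTranspose_mul_sq_le (A B : Matrix ι ι ℂ) :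
    ‖(Aᴴ * B).trace‖ ^ 2 ≤ (Aᴴ * A).trace.re * (Bᴴ * B).trace.re := by
  let vec : Matrix ι ι ℂ → EuclideanSpace ℂ (ι × ι) := fun M => WithLp.toLp 2 fun p => M p.1 p.2
  have key : ∀ M N : Matrix ι ι ℂ, (Mᴴ * N).trace = inner ℂ (vec M) (vec N) := by
    intro M N
    simp only [vec, PiLp.inner_apply, Fintype.sum_prod_type, trace, diag, mul_apply,
      conjTranspose_apply, RCLike.inner_apply]
    rw [Finset.sum_comm]
    refine Finset.sum_congr rfl fun i _ => Finset.sum_congr rfl fun j _ => ?_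
    simp [mul_comm]
  have hself : ∀ M : Matrix ι ι ℂ, (Mᴴ * M).trace.re = ‖vec M‖ ^ 2 := by
    intro M
    rw [key, inner_self_eq_norm_sq_to_K]
    norm_cast
  rw [hself, hself, key, ← mul_pow]
  gcongr
  exact norm_inner_le_norm _ _

theorem PosSemidef.exists_conjTranspose_mul_self {ρ : Matrix ι ι ℂ} (hρ : ρ.PosSemidef) :
    ∃ B : Matrix ι ι ℂ, ρ = Bᴴ * B := by
  open scoped MatrixOrder in
  obtain ⟨B, hB⟩ := CStarAlgebra.nonneg_iff_eq_star_mul_self.mp hρ.nonneg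
  exact ⟨B, hB⟩

/-- The Cauchy-Schwarz inequality for the positive functional `X ↦ Tr[ρ X]`. -/
theorem PosSemidef.norm_trace_mul_sq_le {ρ : Matrix ι ι ℂ} (hρ : ρ.PosSemidef)
    (X Y : Matrix ι ι ℂ) :
    ‖(ρ * (Xᴴ * Y)).trace‖ ^ 2 ≤ (ρ * (Xᴴ * X)).trace.re * (ρ * (Yᴴ * Y)).trace.re := by
  obtain ⟨B, rfl⟩ := hρ.exists_conjTranspose_mul_self
  have key : ∀ M N : Matrix ι ι ℂ,
      (Bᴴ * B * (Mᴴ * N)).trace = ((M * Bᴴ)ᴴ * (N * Bᴴ)).trace := by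
    intro M N
    rw [conjTranspose_mul, conjTranspose_conjTranspose, mul_assoc, trace_mul_comm]
    simp only [mul_assoc]
  rw [key, key, key]
  exact norm_trace_conjTranspose_mul_sq_le _ _

theorem PosSemidef.trace_mul_re_nonneg {ρ X : Matrix ι ι ℂ} (hρ : ρ.PosSemidef)
    (hX : X.PosSemidef) : 0 ≤ (ρ * X).trace.re := by
  obtain ⟨B, rfl⟩ := hρ.exists_conjTranspose_mul_self
  have h := (hX.mul_mul_conjTranspose_same B).trace_nonneg
  rw [mul_assoc, trace_mul_comm]
  exact (Complex.le_def.mp h).1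

theorem posSemidef_norm_sq_sub (X : Matrix ι ι ℂ) :
    (((‖X‖ ^ 2 : ℝ) : ℂ) • (1 : Matrix ι ι ℂ) - Xᴴ * X).PosSemidef := by
  open scoped MatrixOrder in
  have h := CStarAlgebra.star_mul_le_algebraMap_norm_sq (a := X)
  rw [Matrix.le_iff] at h
  have e : ((‖X‖ ^ 2 : ℝ) : ℂ) • (1 : Matrix ι ι ℂ) = algebraMap ℝ (Matrix ι ι ℂ) (‖X‖ ^ 2) := by
    ext i j
    simp [Matrix.algebraMap_matrix_apply, Matrix.one_apply]
  rw [e]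
  exact h

theorem PosSemidef.trace_mul_conjTranspose_mul_self_le {ρ : Matrix ι ι ℂ} (hρ : ρ.PosSemidef)
    (htr : ρ.trace = 1) (X : Matrix ι ι ℂ) : (ρ * (Xᴴ * X)).trace.re ≤ ‖X‖ ^ 2 := by
  have h := hρ.trace_mul_re_nonneg (posSemidef_norm_sq_sub X)
  rw [mul_sub, trace_sub, Matrix.mul_smul, trace_smul, mul_one, htr, Complex.sub_re,
    smul_eq_mul, mul_one, Complex.ofReal_re] at h
  linarith

theorem PosSemidef.norm_trace_mul_le {ρ : Matrix ι ι ℂ} (hρ : ρ.PosSemidef)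
    (htr : ρ.trace = 1) (X : Matrix ι ι ℂ) : ‖(ρ * X).trace‖ ≤ ‖X‖ := by
  have h := hρ.norm_trace_mul_sq_le 1 X
  simp only [conjTranspose_one, one_mul, mul_one, htr, Complex.one_re] at h
  exact abs_le_of_sq_le_sq' (h.trans (hρ.trace_mul_conjTranspose_mul_self_le htr X))
    (norm_nonneg _) |>.2

/-- Cauchy–Schwarz separates X from Q, and Q has weight e² in ρ. This is why every error caused by
the infidelity is linear in e. -/
theorem PosSemidef.norm_trace_mul_mul_le {ρ : Matrix ι ι ℂ} (hρ : ρ.PosSemidef)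
    (htr : ρ.trace = 1) {Q : Matrix ι ι ℂ} (hQ : IsStarProjection Q) {e : ℝ} (he : 0 ≤ e)
    (hQe : (ρ * Q).trace.re = e ^ 2) (X : Matrix ι ι ℂ) : ‖(ρ * (X * Q)).trace‖ ≤ ‖X‖ * e := by
  have h := hρ.norm_trace_mul_sq_le Xᴴ Q
  have hQQ : Qᴴ * Q = Q := by
    rw [show Qᴴ = Q from hQ.isSelfAdjoint, hQ.isIdempotentElem.eq]
  have h2 := hρ.trace_mul_conjTranspose_mul_self_le htr Xᴴ
  rw [hQQ, hQe] at h
  rw [l2_opNorm_conjTranspose] at h2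
  rw [conjTranspose_conjTranspose] at h h2
  refine (abs_le_of_sq_le_sq' ?_ (by positivity)).2
  rw [mul_pow]
  exact h.trans (by gcongr)

omit [DecidableEq ι] in
theorem trace_mul_conjTranspose_of_isHermitian {ρ : Matrix ι ι ℂ} (hρ : ρ.IsHermitian)
    (X : Matrix ι ι ℂ) : (ρ * Xᴴ).trace = star (ρ * X).trace := by
  rw [← trace_conjTranspose, conjTranspose_mul, hρ.eq, trace_mul_comm]

theorem PosSemidef.norm_trace_mul_mul_le' {ρ : Matrix ι ι ℂ} (hρ : ρ.PosSemidef)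
    (htr : ρ.trace = 1) {Q : Matrix ι ι ℂ} (hQ : IsStarProjection Q) {e : ℝ} (he : 0 ≤ e)
    (hQe : (ρ * Q).trace.re = e ^ 2) (X : Matrix ι ι ℂ) : ‖(ρ * (Q * X)).trace‖ ≤ ‖X‖ * e := by
  have h := hρ.norm_trace_mul_mul_le htr hQ he hQe Xᴴ
  have h1 : Q * X = (Xᴴ * Q)ᴴ := by
    rw [conjTranspose_mul, conjTranspose_conjTranspose, show Qᴴ = Q from hQ.isSelfAdjoint]
  rw [h1, trace_mul_conjTranspose_of_isHermitian hρ.isHermitian, norm_star]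
  rwa [l2_opNorm_conjTranspose] at h

/-- Second order perturbation of the ground state: the double commutator of an observable `O ≥ 0`
with kernel `P` and gap `g`, in a state of infidelity `e ^ 2` with `P`. -/
theorem trace_doubleCommutator_ge {σ H O P : Matrix ι ι ℂ} {a h o g e : ℝ}
    (hσ : σ.PosSemidef) (htr : σ.trace = 1) (hH : H.IsHermitian) (hHn : ‖H‖ ≤ h)
    (hO : O.IsHermitian) (hOn : ‖O‖ ≤ o) (hP : IsStarProjection P)
    (hPHP : P * H * P = (a : ℂ) • P) (ha : |a| ≤ h) (hOP : O * P = 0) (hg : 0 ≤ g)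
    (hgap : (O - (g : ℂ) • (1 - P)).PosSemidef) (he : 0 ≤ e)
    (hfid : (σ * P).trace.re = 1 - e ^ 2) :
    2 * g * ((σ * (H * H)).trace.re - (σ * H).trace.re ^ 2) - 2 * e * h ^ 2 * (8 * g + o) ≤
      (σ * (2 • (H * O * H) - H * H * O - O * (H * H))).trace.re := by
  have hh : 0 ≤ h := (norm_nonneg _).trans hHn
  have ho : 0 ≤ o := (norm_nonneg _).trans hOn
  have hQ : IsStarProjection (1 - P) := hP.one_sub
  have hQe : (σ * (1 - P)).trace.re = e ^ 2 := by
    rw [mul_sub, trace_sub, mul_one, htr, Complex.sub_re, hfid]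
    simp
  set Q := 1 - P with hQdef
  have hPn : ‖P‖ ≤ 1 := IsStarProjection.norm_le _ hP
  have hPP : P * P = P := hP.isIdempotentElem.eq
  have hHHn : ‖H * H‖ ≤ h ^ 2 := (norm_mul_le _ _).trans (by nlinarith [norm_nonneg H])
  have hPHn : ‖P * H‖ ≤ h := (norm_mul_le _ _).trans (by nlinarith [norm_nonneg H, norm_nonneg P])
  have hHPn : ‖H * P‖ ≤ h := (norm_mul_le _ _).trans (by nlinarith [norm_nonneg H, norm_nonneg P])
  have hHPHn : ‖H * P * H‖ ≤ h ^ 2 :=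
    (norm_mul_le _ _).trans (by nlinarith [norm_nonneg H, norm_nonneg (H * P)])
  have hPHPHn : ‖P * (H * P * H)‖ ≤ h ^ 2 :=
    (norm_mul_le _ _).trans (by nlinarith [norm_nonneg (H * P * H), norm_nonneg P])
  have right : ∀ X : Matrix ι ι ℂ, ∀ c : ℝ, ‖X‖ ≤ c → |(σ * (X * Q)).trace.re| ≤ c * e :=
    fun X c hX => (Complex.abs_re_le_norm _).trans
      ((hσ.norm_trace_mul_mul_le htr hQ he hQe X).trans (by gcongr))
  have left : ∀ X : Matrix ι ι ℂ, ∀ c : ℝ, ‖X‖ ≤ c → |(σ * (Q * X)).trace.re| ≤ c * e :=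
    fun X c hX => (Complex.abs_re_le_norm _).trans
      ((hσ.norm_trace_mul_mul_le' htr hQ he hQe X).trans (by gcongr))
  -- the terms with `H ^ 2`
  have hOQ : O * Q = O := by rw [hQdef, mul_sub, hOP, mul_one, sub_zero]
  have hQO : Q * O = O := by
    have := congrArg conjTranspose hOQ
    rwa [conjTranspose_mul, hO.eq, show Qᴴ = Q from hQ.isSelfAdjoint] at this
  have e1 : |(σ * (H * H * O)).trace.re| ≤ h ^ 2 * o * e := by
    have := right (H * H * O) (h ^ 2 * o) ((norm_mul_le _ _).trans (by gcongr))
    rwa [mul_assoc (H * H), hOQ] at this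
  have e2 : |(σ * (O * (H * H))).trace.re| ≤ o * h ^ 2 * e := by
    have := left (O * (H * H)) (o * h ^ 2) ((norm_mul_le _ _).trans (by gcongr))
    rwa [← mul_assoc Q, hQO] at this
  -- the sandwiched term
  have e3 : g * ((σ * (H * H)).trace.re - (σ * (H * P * H)).trace.re) ≤
      (σ * (H * O * H)).trace.re := by
    have h1 := hgap.mul_mul_conjTranspose_same H
    rw [hH.eq] at h1
    have h2 := hσ.trace_mul_re_nonneg h1
    have h3 : H * (O - (g : ℂ) • Q) * H =
        H * O * H - (g : ℂ) • (H * H - H * P * H) := by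
      rw [hQdef, mul_sub, sub_mul, Matrix.mul_smul, Matrix.smul_mul, mul_sub, sub_mul, mul_one]
    rw [h3, mul_sub, trace_sub, Matrix.mul_smul, trace_smul, mul_sub, trace_sub, Complex.sub_re,
      smul_eq_mul, Complex.re_ofReal_mul, Complex.sub_re] at h2
    linarith
  -- replacing `σ` by `P`
  have hPQ : ∀ X : Matrix ι ι ℂ, X = P * X * P + P * X * Q + Q * X := by
    intro X
    rw [hQdef]
    noncomm_ring
  have hsandwich : P * (H * P * H) * P = ((a ^ 2 : ℝ) : ℂ) • P := by
    calc P * (H * P * H) * P = (P * H * P) * (P * H * P) := by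
          simp only [mul_assoc]
          rw [← mul_assoc P P, hPP]
      _ = _ := by
          rw [hPHP, Matrix.smul_mul, Matrix.mul_smul, hPP, smul_smul]
          push_cast
          rw [sq]
  -- The block between two copies of P is a multiple of P; each of the two remaining blocks carries
  -- a factor Q on one side and costs h² e.
  have e4 : (σ * (H * P * H)).trace.re ≤ a ^ 2 * (1 - e ^ 2) + 2 * h ^ 2 * e := by
    have h1 := right (P * (H * P * H)) _ hPHPHn
    have h2 := left (H * P * H) _ hHPHn
    rw [hPQ (H * P * H), hsandwich, mul_add, mul_add, trace_add, trace_add, Matrix.mul_smul,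
      trace_smul, smul_eq_mul, Complex.add_re, Complex.add_re, Complex.re_ofReal_mul, hfid]
    linarith [le_abs_self (σ * (P * (H * P * H) * Q)).trace.re,
      le_abs_self (σ * (Q * (H * P * H))).trace.re]
  have e5 : |(σ * H).trace.re - a * (1 - e ^ 2)| ≤ 2 * h * e := by
    have h1 := right (P * H) _ hPHn
    have h2 := left H _ hHn
    nth_rw 1 [hPQ H]
    rw [hPHP, mul_add, mul_add, trace_add, trace_add, Matrix.mul_smul,
      trace_smul, smul_eq_mul, Complex.add_re, Complex.add_re, Complex.re_ofReal_mul, hfid]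
    rw [abs_le] at *
    constructor <;> linarith
  have he1 : e ≤ 1 := by
    have h1 := hσ.trace_mul_re_nonneg (X := P) (by
      have := posSemidef_conjTranspose_mul_self P
      rwa [show Pᴴ = P from hP.isSelfAdjoint, hPP] at this)
    nlinarith
  -- With x = Tr[σH], the deviation |x − a| ≤ 3he consists of 2he from `e5` and he from |a| e² ≤ he.
  -- Then x² ≥ a² + 2a(x − a) produces the 6. Together with the 2 of `e4` it gives the coefficient 8
  -- of g.
  have e6 : a ^ 2 - 6 * h ^ 2 * e ≤ (σ * H).trace.re ^ 2 := by
    set x := (σ * H).trace.re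
    have hx : |x - a| ≤ 3 * h * e := by
      have : x - a = (x - a * (1 - e ^ 2)) + (-(a * e ^ 2)) := by ring
      rw [this]
      refine (abs_add_le _ _).trans ?_
      have h3 : |-(a * e ^ 2)| ≤ h * e := by
        rw [abs_neg, abs_mul, abs_of_nonneg (sq_nonneg e)]
        have : e ^ 2 ≤ e := by nlinarith
        gcongr
      linarith
    have h4 : |a * (x - a)| ≤ h * (3 * h * e) := by
      rw [abs_mul]
      gcongr
    nlinarith [sq_nonneg (x - a), neg_abs_le (a * (x - a))]
  have e7 : (σ * (2 • (H * O * H) - H * H * O - O * (H * H))).trace.re =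
      2 * (σ * (H * O * H)).trace.re - (σ * (H * H * O)).trace.re
        - (σ * (O * (H * H))).trace.re := by
    rw [mul_sub, mul_sub, trace_sub, trace_sub, two_nsmul, mul_add, trace_add]
    simp only [Complex.sub_re, Complex.add_re]
    ring
  rw [e7]
  have e8 : g * (σ * (H * P * H)).trace.re ≤ g * (a ^ 2 + 2 * h ^ 2 * e) := by
    gcongr
    nlinarith [mul_nonneg (sq_nonneg a) (sq_nonneg e)]
  have e9 := mul_le_mul_of_nonneg_left e6 hg
  linarith [le_abs_self (σ * (H * H * O)).trace.re, le_abs_self (σ * (O * (H * H))).trace.re]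

/-- The shift is the midpoint of the spectrum, which leaves a diagonal matrix with entries at most
half the spread. -/
theorem IsHermitian.exists_norm_sub_smul_one_le {H : Matrix ι ι ℂ} (hH : H.IsHermitian) :
    ∃ c : ℝ, ‖H - (c : ℂ) • (1 : Matrix ι ι ℂ)‖ ≤
      ((⨆ i, hH.eigenvalues i) - ⨅ i, hH.eigenvalues i) / 2 := by
  set M := ⨆ i, hH.eigenvalues i
  set m := ⨅ i, hH.eigenvalues i
  refine ⟨(M + m) / 2, ?_⟩
  have hM : ∀ i, hH.eigenvalues i ≤ M := le_ciSup (Set.finite_range _).bddAbove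
  have hm : ∀ i, m ≤ hH.eigenvalues i := ciInf_le (Set.finite_range _).bddBelow
  have e : H - (((M + m) / 2 : ℝ) : ℂ) • (1 : Matrix ι ι ℂ) =
      hH.eigenvectorUnitary * diagonal (fun i => ((hH.eigenvalues i - (M + m) / 2 : ℝ) : ℂ)) *
        star (hH.eigenvectorUnitary : Matrix ι ι ℂ) := by
    have h1 := hH.spectral_theorem
    rw [Unitary.conjStarAlgAut_apply] at h1
    have h2 : diagonal (fun i => ((hH.eigenvalues i - (M + m) / 2 : ℝ) : ℂ)) =
        diagonal (RCLike.ofReal ∘ hH.eigenvalues) -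
          (((M + m) / 2 : ℝ) : ℂ) • (1 : Matrix ι ι ℂ) := by
      rw [← diagonal_one, ← diagonal_smul, diagonal_sub]
      congr 1
      ext i
      simp
    rw [h2, mul_sub, sub_mul, ← h1, Matrix.mul_smul, Matrix.smul_mul, mul_one,
      Unitary.mul_star_self_of_mem hH.eigenvectorUnitary.2]
  rw [e, CStarRing.norm_mul_mem_unitary _ (Unitary.star_mem hH.eigenvectorUnitary.2),
    CStarRing.norm_coe_unitary_mul, l2_opNorm_diagonal]
  rcases isEmpty_or_nonempty ι with hι | ⟨⟨i⟩⟩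
  · have : (fun i => ((hH.eigenvalues i - (M + m) / 2 : ℝ) : ℂ)) = 0 := Subsingleton.elim _ _
    rw [this, norm_zero]
    simp [M, m]
  · refine (pi_norm_le_iff_of_nonneg (by linarith [hM i, hm i])).2 fun i => ?_
    rw [Complex.norm_real, Real.norm_eq_abs, abs_le]
    constructor <;> linarith [hM i, hm i]

/-- A scalar shift of H does not change the commutator, so the spread of H replaces 2‖H‖. -/
theorem norm_commutator_le {H : Matrix ι ι ℂ} {c d : ℂ}
    {w : ℝ} (h : ‖H - c • (1 : Matrix ι ι ℂ)‖ ≤ w / 2) (hd : ‖d‖ = 1) (Y : Matrix ι ι ℂ) :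
    ‖d • (H * Y - Y * H)‖ ≤ w * ‖Y‖ := by
  have e : H * Y - Y * H = (H - c • (1 : Matrix ι ι ℂ)) * Y - Y * (H - c • (1 : Matrix ι ι ℂ)) := by
    rw [sub_mul, mul_sub, Matrix.smul_mul, Matrix.mul_smul, one_mul, mul_one]
    abel
  rw [norm_smul, hd, one_mul, e]
  refine (norm_sub_le _ _).trans ?_
  have h1 := norm_mul_le (H - c • (1 : Matrix ι ι ℂ)) Y
  have h2 := norm_mul_le Y (H - c • (1 : Matrix ι ι ℂ))
  nlinarith [norm_nonneg Y]

/-- The variance of an observable is at most the square of half its spread. -/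
theorem PosSemidef.variance_le {ρ H : Matrix ι ι ℂ} (hρ : ρ.PosSemidef) (htr : ρ.trace = 1)
    (hH : H.IsHermitian) {c w : ℝ} (h : ‖H - (c : ℂ) • (1 : Matrix ι ι ℂ)‖ ≤ w) :
    (ρ * (H * H)).trace.re - (ρ * H).trace.re ^ 2 ≤ w ^ 2 := by
  set X := H - (c : ℂ) • (1 : Matrix ι ι ℂ) with hX
  have hXH : Xᴴ = X := by
    rw [hX, conjTranspose_sub, hH.eq, conjTranspose_smul, conjTranspose_one]
    simp
  have h1 := hρ.trace_mul_conjTranspose_mul_self_le htr X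
  rw [hXH] at h1
  have e : (ρ * (X * X)).trace.re =
      (ρ * (H * H)).trace.re - 2 * c * (ρ * H).trace.re + c ^ 2 := by
    have : X * X = H * H - ((2 * c : ℝ) : ℂ) • H + ((c ^ 2 : ℝ) : ℂ) • (1 : Matrix ι ι ℂ) := by
      rw [hX, sub_mul, mul_sub, mul_sub, Matrix.smul_mul, Matrix.mul_smul, one_mul, mul_one,
        Matrix.smul_mul, one_mul]
      push_cast
      module
    rw [this, mul_add, mul_sub, trace_add, trace_sub, Matrix.mul_smul, Matrix.mul_smul, trace_smul,
      trace_smul, mul_one, htr, Complex.add_re, Complex.sub_re, smul_eq_mul, smul_eq_mul,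
      Complex.re_ofReal_mul, mul_one, Complex.ofReal_re]
  have h2 : ‖X‖ ^ 2 ≤ w ^ 2 := by gcongr
  nlinarith [sq_nonneg (c - (ρ * H).trace.re)]

end Matrix

/-! ### The ground state projection and the spectral gap. -/

namespace EigenDecomp

variable {n : ℕ} {O : QOp n} (E : EigenDecomp O)

theorem mulVec_v (i : Fin (2 ^ n)) : O *ᵥ (E.v i).ofLp = (E.lam i : ℂ) • (E.v i).ofLp := by
  have := congrArg WithLp.ofLp (E.eigen i)
  simpa using this

theorem star_dotProduct_v (i : Fin (2 ^ n)) : star (E.v i).ofLp ⬝ᵥ (E.v i).ofLp = 1 := by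
  have h := E.v.inner_eq_one i
  rw [EuclideanSpace.inner_eq_star_dotProduct, dotProduct_comm] at h
  exact h

theorem abs_lam_le (i : Fin (2 ^ n)) : |E.lam i| ≤ ‖O‖ := by
  have h := Matrix.l2_opNorm_mulVec O (E.v i)
  rw [E.mulVec_v] at h
  have e : (EuclideanSpace.equiv (Fin (2 ^ n)) ℂ).symm ((E.lam i : ℂ) • (E.v i).ofLp) =
      (E.lam i : ℂ) • E.v i := rfl
  rw [e, norm_smul, E.v.norm_eq_one, mul_one, mul_one, Complex.norm_real] at h
  exact h

theorem gap_le : E.gap ≤ 2 * ‖O‖ := by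
  have h1 := E.abs_lam_le 0
  have h2 := E.abs_lam_le 1
  rw [abs_le] at h1 h2
  rw [gap]
  linarith

theorem norm_sub_ground_le :
    ‖O - (E.lam 0 : ℂ) • (1 : QOp n)‖ ≤ 2 * ‖O‖ := by
  refine (norm_sub_le _ _).trans ?_
  have h : ‖(E.lam 0 : ℂ) • (1 : QOp n)‖ ≤ ‖O‖ := by
    rw [norm_smul, norm_one, mul_one, Complex.norm_real]
    exact E.abs_lam_le 0
  linarith

theorem isStarProjection_groundProj : IsStarProjection E.groundProj := by
  constructor
  · rw [IsIdempotentElem, groundProj, Matrix.vecMulVec_mul_vecMulVec, E.star_dotProduct_v, one_smul]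
  · rw [isSelfAdjoint_iff, Matrix.star_eq_conjTranspose, groundProj, Matrix.conjTranspose_vecMulVec,
      star_star]

theorem sub_ground_mul_groundProj :
    (O - (E.lam 0 : ℂ) • (1 : QOp n)) * E.groundProj = 0 := by
  rw [groundProj, Matrix.mul_vecMulVec, Matrix.sub_mulVec, Matrix.smul_mulVec, Matrix.one_mulVec,
    E.mulVec_v, sub_self, Matrix.zero_vecMulVec]

theorem exists_groundProj_mul_mul {H : QOp n} (hH : H.IsHermitian) :
    ∃ a : ℝ, E.groundProj * H * E.groundProj = (a : ℂ) • E.groundProj ∧ |a| ≤ ‖H‖ := by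
  set z : ℂ := star (E.v 0).ofLp ⬝ᵥ H *ᵥ (E.v 0).ofLp with hz
  have h1 : E.groundProj * H * E.groundProj = z • E.groundProj := by
    rw [mul_assoc, groundProj, Matrix.mul_vecMulVec, Matrix.vecMulVec_mul_vecMulVec, Matrix.vecMulVec_smul]
  have hzim : z.im = 0 := by
    have := hH.im_star_dotProduct_mulVec_self (E.v 0).ofLp
    simpa using this
  refine ⟨z.re, ?_, ?_⟩
  · rw [h1]
    congr 1
    apply Complex.ext <;> simp [hzim]
  · have h2 : z = inner ℂ (E.v 0)
        ((EuclideanSpace.equiv (Fin (2 ^ n)) ℂ).symm (H *ᵥ (E.v 0).ofLp)) := by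
      rw [EuclideanSpace.inner_eq_star_dotProduct, dotProduct_comm]
      rfl
    refine (Complex.abs_re_le_norm z).trans ?_
    rw [h2]
    refine (norm_inner_le_norm _ _).trans ?_
    have := Matrix.l2_opNorm_mulVec H (E.v 0)
    rw [E.v.norm_eq_one] at *
    linarith

theorem one_le_of_ne_zero (h : E.lam 0 < E.lam 1) {i : Fin (2 ^ n)} (hi : i ≠ 0) : 1 ≤ i := by
  have h01 : (0 : Fin (2 ^ n)) ≠ 1 := fun e => by rw [← e] at h; exact lt_irrefl _ h
  -- Without qubits the index type has one element, so the indices 0 and 1 coincide and the strict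
  -- inequality of eigenvalues fails.
  rcases n with _ | n
  · exact absurd (Subsingleton.elim (α := Fin 1) 0 1) h01
  · rw [Fin.le_def]
    have h2 : 1 < 2 ^ (n + 1) := Nat.one_lt_two_pow (by omega)
    have h3 : ((1 : Fin (2 ^ (n + 1))) : ℕ) = 1 := by
      rw [Fin.val_one', Nat.mod_eq_of_lt h2]
    have h4 : (i : ℕ) ≠ 0 := fun e => hi (Fin.ext (by simpa using e))
    omega

/-- The matrix is diagonal in the eigenbasis of O, with eigenvalue 0 on the ground state and λ_i −
λ_1 ≥ 0 (counting from λ_0) on the others; it is thus a nonnegative combination of rank one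
projections. -/
theorem posSemidef_sub_gap (h : E.lam 0 < E.lam 1) :
    (O - (E.lam 0 : ℂ) • (1 : QOp n) - (E.gap : ℂ) • (1 - E.groundProj)).PosSemidef := by
  set M : QOp n := O - (E.lam 0 : ℂ) • (1 : QOp n) - (E.gap : ℂ) • (1 - E.groundProj) with hM
  set μ : Fin (2 ^ n) → ℝ := fun i => if i = 0 then 0 else E.lam i - E.lam 1 with hμ
  have hμ0 : ∀ i, 0 ≤ μ i := by
    intro i
    by_cases hi : i = 0
    · simp [hμ, hi]
    · simp only [hμ, hi, if_false, sub_nonneg]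
      exact E.lam_mono (E.one_le_of_ne_zero h hi)
  have horth : ∀ i, i ≠ 0 → star (E.v 0).ofLp ⬝ᵥ (E.v i).ofLp = 0 := by
    intro i hi
    have h := E.v.inner_eq_zero (Ne.symm hi)
    rw [EuclideanSpace.inner_eq_star_dotProduct, dotProduct_comm] at h
    exact h
  have hMv : ∀ i, M *ᵥ (E.v i).ofLp = (μ i : ℂ) • (E.v i).ofLp := by
    intro i
    rw [hM, Matrix.sub_mulVec, Matrix.sub_mulVec, Matrix.smul_mulVec, Matrix.smul_mulVec,
      Matrix.sub_mulVec, Matrix.one_mulVec, E.mulVec_v, groundProj, Matrix.vecMulVec_mulVec]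
    by_cases hi : i = 0
    · subst hi
      rw [E.star_dotProduct_v]
      simp [hμ]
    · rw [horth i hi]
      simp only [hμ, hi, if_false, gap]
      push_cast
      simp only [MulOpposite.op_zero, zero_smul, sub_zero]
      module
  have hsum : M = ∑ i, (μ i : ℂ) • Matrix.vecMulVec (E.v i).ofLp (star (E.v i).ofLp) := by
    apply Matrix.toEuclideanLin.injective
    refine E.v.toBasis.ext fun j => ?_
    simp only [OrthonormalBasis.coe_toBasis]
    ext k
    rw [Matrix.toLpLin_apply, Matrix.toLpLin_apply, Matrix.sum_mulVec, hMv]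
    rw [Finset.sum_eq_single j]
    · rw [Matrix.smul_mulVec, Matrix.vecMulVec_mulVec, E.star_dotProduct_v]
      simp
    · intro i _ hij
      have h0 : star (E.v i).ofLp ⬝ᵥ (E.v j).ofLp = 0 := by
        have h := E.v.inner_eq_zero hij
        rw [EuclideanSpace.inner_eq_star_dotProduct, dotProduct_comm] at h
        exact h
      rw [Matrix.smul_mulVec, Matrix.vecMulVec_mulVec, h0]
      simp
    · simp
  rw [hsum]
  refine Matrix.posSemidef_sum _ fun i _ => ?_
  exact (Matrix.posSemidef_vecMulVec_self_star _).smul (by exact_mod_cast hμ0 i)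

end EigenDecomp

/-! ### Taylor remainders from bounds on derivatives. -/

section Taylor

variable {F : Type*} [NormedAddCommGroup F] [NormedSpace ℝ F]

theorem norm_le_of_hasDerivAt_of_norm_deriv_le_pow {G G' : ℝ → F} {M : ℝ} {k : ℕ}
    (hG : ∀ t, HasDerivAt G (G' t) t) (h0 : G 0 = 0) (hM : ∀ t, 0 ≤ t → ‖G' t‖ ≤ M * t ^ k)
    {t : ℝ} (ht : 0 ≤ t) : ‖G t‖ ≤ M / (k + 1) * t ^ (k + 1) := by
  refine image_norm_le_of_norm_deriv_right_le_deriv_boundary (f := G) (f' := G') (a := 0) (b := t)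
    (B := fun s => M / (k + 1) * s ^ (k + 1)) (B' := fun s => M * s ^ k)
    (fun s _ => (hG s).continuousAt.continuousWithinAt) (fun s _ => (hG s).hasDerivWithinAt)
    (by simp [h0]) (fun s => ?_) (fun s hs => hM s hs.1) ⟨ht, le_rfl⟩
  have h := (hasDerivAt_pow (k + 1) s).const_mul (M / (k + 1))
  refine h.congr_deriv ?_
  have : (k : ℝ) + 1 ≠ 0 := by positivity
  push_cast
  field_simp

/-- Two successive comparisons with a power of t. The case k = 0 bounds second differences, and k =
2 bounds the quartic remainder of the evolution. -/
theorem norm_le_of_norm_second_deriv_le_pow {G G' G'' : ℝ → F} {M : ℝ} {k : ℕ}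
    (hG : ∀ t, HasDerivAt G (G' t) t) (hG' : ∀ t, HasDerivAt G' (G'' t) t)
    (h0 : G 0 = 0) (h0' : G' 0 = 0) (hM : ∀ t, 0 ≤ t → ‖G'' t‖ ≤ M * t ^ k)
    {t : ℝ} (ht : 0 ≤ t) : ‖G t‖ ≤ M / (k + 1) / (k + 2) * t ^ (k + 2) := by
  have h := norm_le_of_hasDerivAt_of_norm_deriv_le_pow hG h0 (k := k + 1)
    (fun s hs => norm_le_of_hasDerivAt_of_norm_deriv_le_pow hG' h0' hM hs) ht
  convert h using 3
  push_cast
  ring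

theorem hasDerivAt_comp_neg {Z : ℝ → F} {Z' : F} {t : ℝ} (h : HasDerivAt Z Z' (-t)) :
    HasDerivAt (fun s => Z (-s)) (-Z') t := by
  simpa [Function.comp_def] using h.scomp t (hasDerivAt_neg t)

end Taylor

/-! ### Matrix curves of bounded frequency and the Heisenberg evolution. -/

namespace Matrix

variable {ι : Type*} [Fintype ι] [DecidableEq ι]

/-- A twice differentiable curve of matrices with the bounds that a trigonometric polynomial of
size `c` and maximal frequency `w` satisfies. -/
def HasBand (c w : ℝ) (Y : ℝ → Matrix ι ι ℂ) : Prop :=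
  ∃ Y' Y'' : ℝ → Matrix ι ι ℂ, (∀ t, HasDerivAt Y (Y' t) t) ∧ (∀ t, HasDerivAt Y' (Y'' t) t) ∧
    (∀ t, ‖Y t‖ ≤ c) ∧ (∀ t, ‖Y' t‖ ≤ c * w) ∧ ∀ t, ‖Y'' t‖ ≤ c * w ^ 2

theorem hasBand_const (O : Matrix ι ι ℂ) : HasBand ‖O‖ 0 fun _ => O :=
  ⟨fun _ => 0, fun _ => 0, fun t => hasDerivAt_const t O, fun t => hasDerivAt_const t 0,
    fun _ => le_rfl, fun _ => by simp, fun _ => by simp⟩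

theorem HasBand.norm_second_difference_le {c w : ℝ} {Y : ℝ → Matrix ι ι ℂ} (h : HasBand c w Y)
    (t : ℝ) : ‖Y t + Y (-t) - (2 : ℝ) • Y 0‖ ≤ c * w ^ 2 * t ^ 2 := by
  wlog ht : 0 ≤ t generalizing t
  · have := this (-t) (by linarith)
    rwa [neg_neg, add_comm (Y (-t)), neg_sq] at this
  obtain ⟨Y', Y'', h1, h2, -, -, h3⟩ := h
  have hneg : ∀ (Z Z' : ℝ → Matrix ι ι ℂ), (∀ t, HasDerivAt Z (Z' t) t) →
      ∀ t, HasDerivAt (fun s => Z (-s)) (-Z' (-t)) t := by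
    exact fun Z Z' hZ t => hasDerivAt_comp_neg (hZ (-t))
  have key := norm_le_of_norm_second_deriv_le_pow (k := 0) (M := 2 * (c * w ^ 2))
    (G := fun t => Y t + Y (-t) - (2 : ℝ) • Y 0) (G' := fun t => Y' t + -Y' (-t))
    (G'' := fun t => Y'' t + - -Y'' (-t))
    (fun t => ((h1 t).add (hneg _ _ h1 t)).sub_const _)
    (fun t => (h2 t).add (hneg _ _ h2 t).neg) (by simp [two_smul]) (by simp)
    (fun s _ => by
      rw [neg_neg]
      refine (norm_add_le _ _).trans ?_
      linarith [h3 s, h3 (-s)]) ht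
  refine key.trans (le_of_eq ?_)
  push_cast
  ring

theorem norm_conjTranspose_mul_mul_of_mem_unitaryGroup {U : Matrix ι ι ℂ}
    (hU : U ∈ unitaryGroup ι ℂ) (X : Matrix ι ι ℂ) : ‖Uᴴ * X * U‖ = ‖X‖ := by
  rw [CStarRing.norm_mul_mem_unitary _ hU, ← star_eq_conjTranspose,
    CStarRing.norm_mem_unitary_mul _ (Unitary.star_mem hU)]

theorem HasBand.conj {c w : ℝ} {Y : ℝ → Matrix ι ι ℂ} (h : HasBand c w Y) {U : Matrix ι ι ℂ}
    (hU : U ∈ unitaryGroup ι ℂ) : HasBand c w fun t => Uᴴ * Y t * U := by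
  obtain ⟨Y', Y'', h1, h2, h3, h4, h5⟩ := h
  have hd : ∀ {Z Z' : ℝ → Matrix ι ι ℂ}, (∀ t, HasDerivAt Z (Z' t) t) →
      ∀ t, HasDerivAt (fun t => Uᴴ * Z t * U) (Uᴴ * Z' t * U) t :=
    fun hZ t => ((hZ t).const_mul Uᴴ).mul_const U
  refine ⟨fun t => Uᴴ * Y' t * U, fun t => Uᴴ * Y'' t * U, hd h1, hd h2, fun t => ?_, fun t => ?_,
    fun t => ?_⟩ <;> rw [norm_conjTranspose_mul_mul_of_mem_unitaryGroup hU]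
  exacts [h3 t, h4 t, h5 t]

/-- The unitary evolution `exp(-i t H)`. -/
noncomputable def evol (H : Matrix ι ι ℂ) (t : ℝ) : Matrix ι ι ℂ :=
  NormedSpace.exp ((-(Complex.I * (t : ℂ))) • H)

/-- The derivation `i [H, ·]` that generates the evolution of observables. -/
noncomputable def liouville (H Y : Matrix ι ι ℂ) : Matrix ι ι ℂ := Complex.I • (H * Y - Y * H)

theorem evol_zero (H : Matrix ι ι ℂ) : evol H 0 = 1 := by
  simp [evol]

theorem evol_add (H : Matrix ι ι ℂ) (s t : ℝ) : evol H (s + t) = evol H s * evol H t := by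
  rw [evol, evol, evol, ← exp_add_of_commute _ _
    (((Commute.refl H).smul_left _).smul_right _), ← add_smul]
  congr 2
  push_cast
  ring

theorem evol_conjTranspose {H : Matrix ι ι ℂ} (hH : H.IsHermitian) (t : ℝ) :
    (evol H t)ᴴ = evol H (-t) := by
  rw [evol, ← exp_conjTranspose, conjTranspose_smul, hH.eq, evol]
  simp

theorem evol_mem_unitaryGroup {H : Matrix ι ι ℂ} (hH : H.IsHermitian) (t : ℝ) :
    evol H t ∈ unitaryGroup ι ℂ := by
  rw [mem_unitaryGroup_iff', star_eq_conjTranspose, evol_conjTranspose hH, ← evol_add,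
    neg_add_cancel, evol_zero]

theorem hasDerivAt_evol (H : Matrix ι ι ℂ) (t : ℝ) :
    HasDerivAt (evol H) (evol H t * ((-Complex.I) • H)) t := by
  have h := hasDerivAt_exp_smul_const ((-Complex.I) • H) t
  have e : ∀ u : ℝ, u • (-Complex.I) • H = (-(Complex.I * (u : ℂ))) • H := by
    intro u
    rw [← Complex.coe_smul, smul_smul]
    congr 1
    ring
  simp only [e] at h
  exact h

theorem evol_mul_comm (H : Matrix ι ι ℂ) (t : ℝ) : evol H t * H = H * evol H t := by
  have : Commute H (evol H t) := ((Commute.refl H).smul_right _).exp_right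
  exact this.eq.symm

theorem hasDerivAt_evol_conj (H : Matrix ι ι ℂ) {Y Y' : ℝ → Matrix ι ι ℂ} {t : ℝ}
    (hY : HasDerivAt Y (Y' t) t) :
    HasDerivAt (fun t => evol H (-t) * Y t * evol H t)
      (evol H (-t) * (Y' t + liouville H (Y t)) * evol H t) t := by
  have h1 : HasDerivAt (fun s => evol H (-s)) (-(evol H (-t) * ((-Complex.I) • H))) t := by
    exact hasDerivAt_comp_neg (hasDerivAt_evol H (-t))
  refine ((h1.mul hY).mul (hasDerivAt_evol H t)).congr_deriv ?_
  have e : evol H t * ((-Complex.I) • H) = ((-Complex.I) • H) * evol H t := by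
    rw [Matrix.mul_smul, evol_mul_comm, Matrix.smul_mul]
  rw [e, liouville]
  simp only [neg_smul, mul_neg, neg_mul, neg_neg, Matrix.smul_mul, Matrix.mul_smul, mul_add,
    add_mul, mul_sub, sub_mul, smul_sub, mul_assoc, Pi.mul_apply]
  abel

theorem liouville_add (H X Y : Matrix ι ι ℂ) :
    liouville H (X + Y) = liouville H X + liouville H Y := by
  rw [liouville, liouville, liouville, mul_add, add_mul, ← smul_add]
  congr 1
  abel

omit [DecidableEq ι] in
theorem liouville_sub (H X Y : Matrix ι ι ℂ) :
    liouville H (X - Y) = liouville H X - liouville H Y := by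
  rw [liouville, liouville, liouville, mul_sub, sub_mul, ← smul_sub]
  congr 1
  abel

omit [DecidableEq ι] in
theorem liouville_real_smul (H : Matrix ι ι ℂ) (r : ℝ) (Y : Matrix ι ι ℂ) :
    liouville H (r • Y) = r • liouville H Y := by
  rw [liouville, liouville, Matrix.mul_smul, Matrix.smul_mul, ← smul_sub, smul_comm]

theorem hasDerivAt_liouville (H : Matrix ι ι ℂ) {Y : ℝ → Matrix ι ι ℂ} {Y' : Matrix ι ι ℂ} {t : ℝ}
    (hY : HasDerivAt Y Y' t) : HasDerivAt (fun t => liouville H (Y t)) (liouville H Y') t :=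
  ((hY.const_mul H).sub (hY.mul_const H)).const_smul Complex.I

/-- Conjugation by the evolution `exp(-i t H)` adds the spread `v` of `H` to the band. -/
theorem HasBand.conj_evol {c w v : ℝ} {Y : ℝ → Matrix ι ι ℂ} (h : HasBand c w Y)
    {H : Matrix ι ι ℂ} (hH : H.IsHermitian) (hv : ∀ X, ‖liouville H X‖ ≤ v * ‖X‖) (hv0 : 0 ≤ v) :
    HasBand c (w + v) fun t => (evol H t)ᴴ * Y t * evol H t := by
  obtain ⟨Y', Y'', h1, h2, h3, h4, h5⟩ := h
  have hnorm : ∀ t X, ‖evol H (-t) * X * evol H t‖ = ‖X‖ := fun t X => by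
    rw [← evol_conjTranspose hH,
      norm_conjTranspose_mul_mul_of_mem_unitaryGroup (evol_mem_unitaryGroup hH t)]
  simp only [evol_conjTranspose hH]
  have hd1 : ∀ t, HasDerivAt (fun t => Y' t + liouville H (Y t))
      (Y'' t + liouville H (Y' t)) t := fun t => (h2 t).add (hasDerivAt_liouville H (h1 t))
  refine ⟨_, _, fun t => hasDerivAt_evol_conj H (h1 t), fun t => hasDerivAt_evol_conj H
    (Y' := fun t => Y'' t + liouville H (Y' t)) (hd1 t), fun t => ?_, fun t => ?_, fun t => ?_⟩
  · rw [hnorm]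
    exact h3 t
  · rw [hnorm]
    refine (norm_add_le _ _).trans ?_
    nlinarith [hv (Y t), h3 t, h4 t]
  · rw [hnorm]
    refine (norm_add_le _ _).trans ?_
    have e1 : ‖Y'' t + liouville H (Y' t)‖ ≤ c * w ^ 2 + v * (c * w) :=
      (norm_add_le _ _).trans (add_le_add (h5 t) ((hv _).trans (by gcongr; exact h4 t)))
    have e2 : ‖liouville H (Y' t + liouville H (Y t))‖ ≤ v * (c * w + v * c) := by
      refine (hv _).trans ?_
      gcongr
      exact (norm_add_le _ _).trans (add_le_add (h4 t) ((hv _).trans (by gcongr; exact h3 t)))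
    refine (add_le_add e1 e2).trans (le_of_eq ?_)
    ring

/-- The leftmost factor is innermost in the conjugation of the observable, so the induction absorbs
it into Y before treating the remaining factors. -/
theorem HasBand.conj_list_prod {k : ℕ} {G : Fin k → ℝ → Matrix ι ι ℂ} {v : Fin k → ℝ}
    (hG : ∀ l c w Y, HasBand c w Y → HasBand c (w + v l) fun t => (G l t)ᴴ * Y t * G l t)
    {c w : ℝ} {Y : ℝ → Matrix ι ι ℂ} (h : HasBand c w Y) :
    HasBand c (w + ∑ l, v l) fun t =>
      ((List.ofFn fun l => G l t).prod)ᴴ * Y t * (List.ofFn fun l => G l t).prod := by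
  induction k generalizing w Y with
  | zero => simpa using h
  | succ k ih =>
    have h1 := ih (G := fun l => G l.succ) (v := fun l => v l.succ) (fun l => hG l.succ)
      (hG 0 c w Y h)
    rw [Fin.sum_univ_succ, ← add_assoc]
    convert h1 using 2 with t
    rw [List.ofFn_succ, List.prod_cons, conjTranspose_mul]
    simp only [mul_assoc]

/-- The even part of the evolution of an observable, to fourth order. -/
theorem norm_evol_conj_add_evol_conj_sub_le {H : Matrix ι ι ℂ} (hH : H.IsHermitian) {v : ℝ}
    (hv : ∀ X, ‖liouville H X‖ ≤ v * ‖X‖) (hv0 : 0 ≤ v) (Y : Matrix ι ι ℂ) (t : ℝ) :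
    ‖(evol H t)ᴴ * Y * evol H t + (evol H (-t))ᴴ * Y * evol H (-t) - (2 : ℝ) • Y
      - t ^ 2 • liouville H (liouville H Y)‖ ≤ ‖Y‖ * v ^ 4 / 12 * t ^ 4 := by
  wlog ht : 0 ≤ t generalizing t
  · have := this (-t) (by linarith)
    rw [neg_neg, neg_sq, add_comm (_ * _ * evol H (-t))] at this
    refine this.trans (le_of_eq ?_)
    ring
  set Z : Matrix ι ι ℂ → ℝ → Matrix ι ι ℂ := fun X t => (evol H t)ᴴ * X * evol H t with hZ
  have hd : ∀ X t, HasDerivAt (Z X) (Z (liouville H X) t) t := by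
    intro X t
    have h := hasDerivAt_evol_conj H (Y := fun _ => X) (Y' := fun _ => 0) (hasDerivAt_const t X)
    simp only [hZ, evol_conjTranspose hH]
    simpa using h
  have hZ0 : ∀ X, Z X 0 = X := fun X => by simp [hZ, evol_zero]
  have hdn : ∀ X t, HasDerivAt (fun s => Z X (-s)) (-Z (liouville H X) (-t)) t := by
    exact fun X t => hasDerivAt_comp_neg (hd X (-t))
  set L := liouville H Y
  set L2 := liouville H L
  have hsq : ∀ t : ℝ, HasDerivAt (fun s : ℝ => s ^ 2 • L2) ((2 * t) • L2) t := by
    intro t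
    simpa using (hasDerivAt_pow 2 t).smul_const L2
  have hlin : ∀ t : ℝ, HasDerivAt (fun s : ℝ => (2 * s) • L2) ((2 : ℝ) • L2) t := by
    intro t
    simpa using ((hasDerivAt_id t).const_mul 2).smul_const L2
  have hL2 : ‖L2‖ ≤ v ^ 2 * ‖Y‖ := by
    refine (hv L).trans ?_
    have := hv Y
    nlinarith
  have hband : HasBand (v ^ 2 * ‖Y‖) (0 + v) (Z L2) := by
    have h0 : HasBand (v ^ 2 * ‖Y‖) 0 fun _ => L2 :=
      ⟨fun _ => 0, fun _ => 0, fun t => hasDerivAt_const t _, fun t => hasDerivAt_const t 0,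
        fun _ => hL2, fun _ => by simp, fun _ => by simp⟩
    exact h0.conj_evol hH hv hv0
  -- The second derivative of the remainder is itself the symmetric second difference of the evolved
  -- L2, hence of size v⁴‖Y‖ t². Integrating twice gives the factor 1/(3 · 4) = 1/12.
  have key := norm_le_of_norm_second_deriv_le_pow (k := 2) (M := v ^ 4 * ‖Y‖)
    (G := fun t => Z Y t + Z Y (-t) - (2 : ℝ) • Y - t ^ 2 • L2)
    (G' := fun t => Z L t + -Z L (-t) - (2 * t) • L2)
    (G'' := fun t => Z L2 t + - -Z L2 (-t) - (2 : ℝ) • L2)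
    (fun t => (((hd Y t).add (hdn Y t)).sub_const _).sub (hsq t))
    (fun t => ((hd L t).add (hdn L t).neg).sub (hlin t)) (by simp [hZ0, two_smul]) (by simp)
    (fun s _ => by
      have := hband.norm_second_difference_le s
      rw [hZ0] at this
      rw [neg_neg]
      refine this.trans (le_of_eq ?_)
      ring) ht
  refine key.trans (le_of_eq ?_)
  push_cast
  ring

end Matrix

/-! ### The loss along coordinate lines, and its curvature near the ground state. -/

namespace VarProblem

open Matrix

variable {n m K : ℕ} (P : VarProblem n m K)

/-- The observable pulled back through the circuit. -/
noncomputable def heis (θ : Fin m → ℝ) : QOp n := (P.circuit θ)ᴴ * P.O * P.circuit θ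

/-- The second derivative of the loss in the direction of the last parameter. -/
noncomputable def lossCurv (θ : Fin m → ℝ) : ℝ :=
  (P.ρ * liouville P.lastH (liouville P.lastH (P.heis θ))).trace.re

theorem loss_eq (θ : Fin m → ℝ) : P.loss θ = (P.ρ * P.heis θ).trace.re := by
  rw [loss, evolved, heis, mul_assoc, mul_assoc, trace_mul_comm]
  simp only [mul_assoc]

theorem gateFreq_nonneg (l : Fin (K + 1)) : 0 ≤ P.gateFreq l := by
  obtain ⟨c, hc⟩ := (P.H_herm l).exists_norm_sub_smul_one_le
  have := (norm_nonneg _).trans hc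
  rw [gateFreq]
  linarith

theorem maxFreq_nonneg (q : Fin m) : 0 ≤ P.maxFreq q :=
  Finset.sum_nonneg fun l _ => P.gateFreq_nonneg l

theorem norm_liouville_le (l : Fin (K + 1)) (X : QOp n) :
    ‖liouville (P.H l) X‖ ≤ P.gateFreq l * ‖X‖ := by
  obtain ⟨c, hc⟩ := (P.H_herm l).exists_norm_sub_smul_one_le
  exact norm_commutator_le hc Complex.norm_I X

theorem gate_eq (l : Fin (K + 1)) (t : ℝ) : P.gate l t = (P.V l : QOp n) * evol (P.H l) t := rfl

theorem gate_mem_unitaryGroup (l : Fin (K + 1)) (t : ℝ) :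
    P.gate l t ∈ unitaryGroup (Fin (2 ^ n)) ℂ :=
  mul_mem (P.V l).2 (evol_mem_unitaryGroup (P.H_herm l) t)

theorem circuit_mem_unitaryGroup (θ : Fin m → ℝ) :
    P.circuit θ ∈ unitaryGroup (Fin (2 ^ n)) ℂ := by
  refine Submonoid.list_prod_mem _ fun x hx => ?_
  obtain ⟨l, rfl⟩ := (List.mem_ofFn' _ _).1 hx
  exact P.gate_mem_unitaryGroup _ _

theorem norm_heis (θ : Fin m → ℝ) : ‖P.heis θ‖ = ‖P.O‖ :=
  norm_conjTranspose_mul_mul_of_mem_unitaryGroup (P.circuit_mem_unitaryGroup θ) _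

/-- Gates carrying parameter j each add their spread to the frequency, and all others are fixed
unitary conjugations, which add nothing. -/
theorem hasBand_heis (θ : Fin m → ℝ) (j : Fin m) :
    HasBand ‖P.O‖ (P.maxFreq j) fun t => P.heis (Function.update θ j (θ j + t)) := by
  have h := HasBand.conj_list_prod
    (G := fun l t => P.gate l (Function.update θ j (θ j + t) (P.S l)))
    (v := fun l => if P.S l = j then P.gateFreq l else 0) (fun l c w Y hY => ?_) (hasBand_const P.O)
  · rw [zero_add, ← Finset.sum_filter] at h
    exact h
  · by_cases hl : P.S l = j
    · simp only [hl, if_true, Function.update_self]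
      have h1 := (hY.conj (P.gate_mem_unitaryGroup l (θ j))).conj_evol (P.H_herm l)
        (P.norm_liouville_le l) (P.gateFreq_nonneg l)
      convert h1 using 2 with t
      rw [gate_eq, gate_eq, evol_add]
      simp only [conjTranspose_mul, mul_assoc]
    · simp only [hl, if_false, Function.update_of_ne hl, add_zero]
      exact hY.conj (P.gate_mem_unitaryGroup l (θ (P.S l)))

theorem abs_re_trace_mul_le (X : QOp n) : |(P.ρ * X).trace.re| ≤ ‖X‖ :=
  (Complex.abs_re_le_norm _).trans (P.ρ_psd.norm_trace_mul_le P.ρ_trace X)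

theorem re_trace_mul_real_smul (r : ℝ) (X : QOp n) :
    (P.ρ * (r • X)).trace.re = r * (P.ρ * X).trace.re := by
  rw [Matrix.mul_smul, trace_smul, Complex.real_smul, Complex.re_ofReal_mul]

theorem re_trace_mul_add (X Y : QOp n) :
    (P.ρ * (X + Y)).trace.re = (P.ρ * X).trace.re + (P.ρ * Y).trace.re := by
  rw [mul_add, trace_add, Complex.add_re]

theorem re_trace_mul_sub (X Y : QOp n) :
    (P.ρ * (X - Y)).trace.re = (P.ρ * X).trace.re - (P.ρ * Y).trace.re := by
  rw [mul_sub, trace_sub, Complex.sub_re]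

theorem norm_liouville_liouville_le (X : QOp n) :
    ‖liouville P.lastH (liouville P.lastH X)‖ ≤ P.gateFreq (Fin.last K) ^ 2 * ‖X‖ := by
  have h1 := P.norm_liouville_le (Fin.last K) (liouville P.lastH X)
  have h2 := P.norm_liouville_le (Fin.last K) X
  have h3 := P.gateFreq_nonneg (Fin.last K)
  rw [lastH] at *
  nlinarith

/-- The double commutator is linear and does not depend on θ, so it can be applied to the second
difference of the pulled-back observable at the cost of a squared spread. -/
theorem abs_lossCurv_second_difference_le (θ : Fin m → ℝ) (j : Fin m) (t : ℝ) :
    |P.lossCurv (Function.update θ j (θ j + t)) + P.lossCurv (Function.update θ j (θ j - t))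
      - 2 * P.lossCurv θ| ≤
      ‖P.O‖ * P.gateFreq (Fin.last K) ^ 2 * P.maxFreq j ^ 2 * t ^ 2 := by
  have h := (P.hasBand_heis θ j).norm_second_difference_le t
  rw [add_zero, Function.update_eq_self, ← sub_eq_add_neg] at h
  have h2 := P.norm_liouville_liouville_le (P.heis (Function.update θ j (θ j + t)) +
    P.heis (Function.update θ j (θ j - t)) - (2 : ℝ) • P.heis θ)
  have h3 := (P.abs_re_trace_mul_le _).trans
    (h2.trans (mul_le_mul_of_nonneg_left h (sq_nonneg _)))
  rw [liouville_sub, liouville_sub, liouville_add, liouville_add, liouville_real_smul,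
    liouville_real_smul, re_trace_mul_sub, re_trace_mul_add, re_trace_mul_real_smul] at h3
  refine h3.trans (le_of_eq ?_)
  ring


theorem maxFreq_lastParam (hunc : ∀ l, P.S l = P.lastParam → l = Fin.last K) :
    P.maxFreq P.lastParam = P.gateFreq (Fin.last K) := by
  rw [maxFreq, Finset.sum_eq_single (Fin.last K)]
  · intro l hl hne
    exact absurd (hunc l (Finset.mem_filter.1 hl).2) hne
  · intro h
    exact (h (Finset.mem_filter.2 ⟨Finset.mem_univ _, rfl⟩)).elim

/-- The exponential of the last gate is the rightmost factor of the whole circuit, and no other gate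
sees its parameter. Derivatives in this direction thus become commutators with the last generator,
taken in the input state. -/
theorem circuit_update_lastParam (hunc : ∀ l, P.S l = P.lastParam → l = Fin.last K)
    (θ : Fin m → ℝ) (t : ℝ) :
    P.circuit (Function.update θ P.lastParam (θ P.lastParam + t)) =
      P.circuit θ * evol P.lastH t := by
  have h : ∀ i : Fin K, P.S i.castSucc ≠ P.lastParam := fun i hi =>
    (Fin.castSucc_lt_last i).ne (hunc _ hi)
  rw [circuit, circuit, List.ofFn_succ', List.ofFn_succ', List.prod_concat, List.prod_concat,
    mul_assoc]
  congr 2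
  · simp only [Function.update_of_ne (h _)]
  · change P.gate _ (Function.update θ P.lastParam (θ P.lastParam + t) P.lastParam) = _
    rw [Function.update_self, gate_eq, evol_add, ← mul_assoc]
    rfl

theorem heis_update_lastParam (hunc : ∀ l, P.S l = P.lastParam → l = Fin.last K)
    (θ : Fin m → ℝ) (t : ℝ) :
    P.heis (Function.update θ P.lastParam (θ P.lastParam + t)) =
      (evol P.lastH t)ᴴ * P.heis θ * evol P.lastH t := by
  rw [heis, P.circuit_update_lastParam hunc, heis, conjTranspose_mul]
  simp only [mul_assoc]

theorem abs_loss_add_loss_sub_le (hunc : ∀ l, P.S l = P.lastParam → l = Fin.last K)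
    (θ : Fin m → ℝ) (t : ℝ) :
    |P.loss (Function.update θ P.lastParam (θ P.lastParam + t)) +
      P.loss (Function.update θ P.lastParam (θ P.lastParam - t)) - 2 * P.loss θ -
      t ^ 2 * P.lossCurv θ| ≤ ‖P.O‖ * P.gateFreq (Fin.last K) ^ 4 / 12 * t ^ 4 := by
  have h := norm_evol_conj_add_evol_conj_sub_le (P.H_herm (Fin.last K))
    (P.norm_liouville_le (Fin.last K)) (P.gateFreq_nonneg _) (P.heis θ) t
  have h2 := (P.abs_re_trace_mul_le _).trans h
  rw [re_trace_mul_sub, re_trace_mul_sub, re_trace_mul_add, re_trace_mul_real_smul,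
    re_trace_mul_real_smul, P.norm_heis] at h2
  rw [sub_eq_add_neg (θ P.lastParam), loss_eq, loss_eq, loss_eq, P.heis_update_lastParam hunc,
    P.heis_update_lastParam hunc]
  exact h2

theorem continuous_circuit : Continuous P.circuit := by
  have key : ∀ (k : ℕ) (G : Fin k → (Fin m → ℝ) → QOp n), (∀ l, Continuous (G l)) →
      Continuous fun θ => (List.ofFn fun l => G l θ).prod := by
    intro k
    induction k with
    | zero => intro G _; simpa using continuous_const
    | succ k ih =>
      intro G hG
      simp only [List.ofFn_succ, List.prod_cons]
      exact (hG 0).mul (ih _ fun l => hG l.succ)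
  refine key _ _ fun l => ?_
  have h : Continuous (evol (P.H l)) :=
    continuous_iff_continuousAt.2 fun t => (hasDerivAt_evol (P.H l) t).continuousAt
  exact continuous_const.mul (h.comp (continuous_apply (P.S l)))

theorem continuous_heis : Continuous P.heis :=
  (P.continuous_circuit.matrix_conjTranspose.mul continuous_const).mul P.continuous_circuit

theorem continuous_loss : Continuous P.loss := by
  have : P.loss = fun θ => (P.ρ * P.heis θ).trace.re := funext P.loss_eq
  rw [this]
  exact Complex.continuous_re.comp (continuous_const.mul P.continuous_heis).matrix_trace

theorem continuous_lossCurv : Continuous P.lossCurv := by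
  have h : ∀ f : (Fin m → ℝ) → QOp n, Continuous f → Continuous fun θ => liouville P.lastH (f θ) :=
    fun f hf => ((continuous_const.mul hf).sub (hf.mul continuous_const)).const_smul Complex.I
  exact Complex.continuous_re.comp
    (continuous_const.mul (h _ (h _ P.continuous_heis))).matrix_trace

theorem evolved_posSemidef (θ : Fin m → ℝ) : (P.evolved θ).PosSemidef :=
  P.ρ_psd.mul_mul_conjTranspose_same _

theorem conjTranspose_circuit_mul (θ : Fin m → ℝ) : (P.circuit θ)ᴴ * P.circuit θ = 1 :=
  mem_unitaryGroup_iff'.1 (P.circuit_mem_unitaryGroup θ)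

theorem trace_evolved_mul (θ : Fin m → ℝ) (X : QOp n) :
    (P.evolved θ * X).trace = (P.ρ * ((P.circuit θ)ᴴ * X * P.circuit θ)).trace := by
  rw [evolved, mul_assoc, mul_assoc, trace_mul_comm]
  simp only [mul_assoc]

theorem evolved_trace (θ : Fin m → ℝ) : (P.evolved θ).trace = 1 := by
  have h := P.trace_evolved_mul θ 1
  rwa [mul_one, mul_one, conjTranspose_circuit_mul, mul_one, P.ρ_trace] at h

/-- Near the ground state the loss curves upwards in the direction of the last parameter. -/
theorem lossCurv_ge (E : EigenDecomp P.O) (θ : Fin m → ℝ) {e : ℝ} (he : 0 ≤ e)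
    (hgap : E.lam 0 < E.lam 1)
    (hfid : (P.evolved θ * E.groundProj).trace = ((1 - e ^ 2 : ℝ) : ℂ)) :
    2 * (E.gap * P.stateVar - e * ‖P.lastH‖ ^ 2 * (8 * E.gap + 2 * ‖P.O‖)) ≤ P.lossCurv θ := by
  set U := P.circuit θ with hU
  have hUU : Uᴴ * U = 1 := P.conjTranspose_circuit_mul θ
  set H := P.lastH with hHdef
  have hH : H.IsHermitian := P.H_herm _
  -- Moving the generator to the output side lets the perturbation bound be applied to the evolved
  -- state; its moments there are those of the original generator in ρ.
  set H' : QOp n := U * H * Uᴴ with hH'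
  have hH'h : H'.IsHermitian := isHermitian_mul_mul_conjTranspose U hH
  have hH'n : ‖H'‖ ≤ ‖H‖ := by
    have h1 := norm_conjTranspose_mul_mul_of_mem_unitaryGroup
      (Unitary.star_mem (P.circuit_mem_unitaryGroup θ)) H
    rw [star_eq_conjTranspose, conjTranspose_conjTranspose] at h1
    exact h1.le
  obtain ⟨a, ha, han⟩ := E.exists_groundProj_mul_mul hH'h
  -- Shifting the ground energy to 0 leaves the double commutator unchanged. The price is the norm
  -- bound 2‖O‖, the source of the coefficient 2 of ‖O‖.
  set O' : QOp n := P.O - (E.lam 0 : ℂ) • (1 : QOp n) with hO'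
  have hO'h : O'.IsHermitian := by
    rw [hO']
    refine P.O_herm.sub ?_
    rw [IsHermitian, conjTranspose_smul, conjTranspose_one]
    simp
  have key := trace_doubleCommutator_ge (P.evolved_posSemidef θ) (P.evolved_trace θ) hH'h hH'n
    hO'h E.norm_sub_ground_le E.isStarProjection_groundProj ha (han.trans hH'n)
    E.sub_ground_mul_groundProj (sub_nonneg.2 hgap.le) (E.posSemidef_sub_gap hgap) he
    (by rw [hfid, Complex.ofReal_re])
  have hcancel : ∀ X : QOp n, Uᴴ * (U * X) = X := fun X => by rw [← mul_assoc, hUU, one_mul]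
  have h1 : (P.evolved θ * (H' * H')).trace = (P.ρ * (H * H)).trace := by
    rw [trace_evolved_mul, ← hU, hH']
    simp only [mul_assoc, hcancel, hUU, mul_one]
  have h2 : (P.evolved θ * H').trace = (P.ρ * H).trace := by
    rw [trace_evolved_mul, ← hU, hH']
    simp only [mul_assoc, hcancel, hUU, mul_one]
  have h3 : (P.evolved θ * (2 • (H' * O' * H') - H' * H' * O' - O' * (H' * H'))).trace =
      (P.ρ * liouville H (liouville H (P.heis θ))).trace := by
    rw [trace_evolved_mul, ← hU]
    congr 2
    have e1 : 2 • (H' * O' * H') - H' * H' * O' - O' * (H' * H') =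
        2 • (H' * P.O * H') - H' * H' * P.O - P.O * (H' * H') := by
      rw [hO']
      simp only [mul_sub, sub_mul, Matrix.mul_smul, Matrix.smul_mul, one_mul, mul_one, two_nsmul]
      abel
    have e2 : Uᴴ * (2 • (H' * P.O * H') - H' * H' * P.O - P.O * (H' * H')) * U =
        2 • (H * P.heis θ * H) - H * H * P.heis θ - P.heis θ * (H * H) := by
      rw [heis, ← hU, hH']
      simp only [mul_sub, sub_mul, two_nsmul, mul_add, add_mul, mul_assoc, hcancel, hUU, mul_one]
    rw [e1, e2, liouville, liouville, Matrix.mul_smul, Matrix.smul_mul, ← smul_sub, smul_smul,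
      Complex.I_mul_I, neg_one_smul]
    simp only [mul_sub, sub_mul, two_nsmul, mul_assoc]
    abel
  rw [h1, h2, h3] at key
  rw [lossCurv, stateVar, ← hHdef, EigenDecomp.gap]
  linarith

end VarProblem

/-! ### Uniform laws on intervals and boxes, reflections, and the Legendre correlation. -/

/-- The uniform distribution on an interval of half-width `r` around `c`. -/
noncomputable def uniformIcc (c r : ℝ) : Measure ℝ := cond volume (Set.Icc (c - r) (c + r))

theorem isProbabilityMeasure_uniformIcc (c : ℝ) {r : ℝ} (hr : 0 < r) :
    IsProbabilityMeasure (uniformIcc c r) :=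
  cond_isProbabilityMeasure_of_finite (by simp [Real.volume_Icc]; linarith)
    (by simp [Real.volume_Icc])

theorem uniformIcc_eq (c r : ℝ) : uniformIcc c r =
    (ENNReal.ofReal (2 * r))⁻¹ • volume.restrict (Set.Icc (c - r) (c + r)) := by
  rw [uniformIcc, ProbabilityTheory.cond, Real.volume_Icc]
  congr 3
  ring

theorem measurePreserving_reflect_uniformIcc (c r : ℝ) :
    MeasurePreserving (fun x => 2 * c - x) (uniformIcc c r) (uniformIcc c r) := by
  rw [uniformIcc_eq]
  refine MeasurePreserving.smul_measure ?_ _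
  have h := (Measure.measurePreserving_sub_left (volume : Measure ℝ) (2 * c)).restrict_preimage
    (measurableSet_Icc (a := c - r) (b := c + r))
  have e : (fun x => 2 * c - x) ⁻¹' Set.Icc (c - r) (c + r) = Set.Icc (c - r) (c + r) := by
    rw [Set.preimage_const_sub_Icc]
    congr 1 <;> ring
  rwa [e] at h

theorem integral_uniformIcc (c : ℝ) {r : ℝ} (hr : 0 < r) (g : ℝ → ℝ) :
    ∫ x, g (x - c) ∂uniformIcc c r = (2 * r)⁻¹ * ∫ x in (-r)..r, g x := by
  rw [uniformIcc_eq, integral_smul_measure, ENNReal.toReal_inv,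
    ENNReal.toReal_ofReal (by positivity), smul_eq_mul, integral_Icc_eq_integral_Ioc,
    ← intervalIntegral.integral_of_le (by linarith), intervalIntegral.integral_comp_sub_right]
  congr 2 <;> ring

theorem integral_uniformIcc_quadratic (c : ℝ) {r : ℝ} (hr : 0 < r) :
    ∫ x, ((x - c) ^ 2 - r ^ 2 / 3) ∂uniformIcc c r = 0 := by
  rw [integral_uniformIcc c hr fun y => y ^ 2 - r ^ 2 / 3,
    intervalIntegral.integral_sub (Continuous.intervalIntegrable (by fun_prop) _ _)
      (Continuous.intervalIntegrable (by fun_prop) _ _), integral_pow,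
    intervalIntegral.integral_const, smul_eq_mul]
  field_simp
  push_cast
  ring

/-- The constant is 1/5 − 1/9. As the quadratic has mean zero, this is also its squared norm. -/
theorem integral_uniformIcc_quadratic_mul_sq (c : ℝ) {r : ℝ} (hr : 0 < r) :
    ∫ x, ((x - c) ^ 2 - r ^ 2 / 3) * (x - c) ^ 2 ∂uniformIcc c r = 4 / 45 * r ^ 4 := by
  rw [integral_uniformIcc c hr fun y => (y ^ 2 - r ^ 2 / 3) * y ^ 2]
  have e : ∀ y : ℝ, (y ^ 2 - r ^ 2 / 3) * y ^ 2 = y ^ 4 - r ^ 2 / 3 * y ^ 2 := fun y => by ring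
  simp only [e]
  rw [intervalIntegral.integral_sub (Continuous.intervalIntegrable (by fun_prop) _ _)
    (Continuous.intervalIntegrable (by fun_prop) _ _), integral_pow,
    intervalIntegral.integral_const_mul, integral_pow]
  field_simp
  push_cast
  ring

section Box

variable {m : ℕ}

theorem cond_volume_Icc_eq_pi (φ : Fin m → ℝ) {r : ℝ} (hr : 0 < r) :
    cond (volume : Measure (Fin m → ℝ)) (Set.Icc (fun i => φ i - r) (fun i => φ i + r)) =
      Measure.pi fun i => uniformIcc (φ i) r := by
  have := fun i => isProbabilityMeasure_uniformIcc (φ i) hr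
  refine (Measure.pi_eq fun s _ => ?_).symm
  rw [cond_apply measurableSet_Icc, ← Set.pi_univ_Icc, ← Set.pi_inter_distrib, volume_pi_pi,
    volume_pi_pi]
  simp only [uniformIcc, cond_apply measurableSet_Icc, Finset.prod_mul_distrib]
  congr 1
  simp only [Real.volume_Icc, add_sub_sub_cancel, Finset.prod_const, ENNReal.inv_pow]

variable (φ : Fin m → ℝ) {r : ℝ} (hr : 0 < r)
include hr

theorem ae_abs_sub_le_pi_uniformIcc :
    ∀ᵐ x ∂Measure.pi fun i => uniformIcc (φ i) r, ∀ i, |x i - φ i| ≤ r := by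
  rw [← cond_volume_Icc_eq_pi φ hr]
  filter_upwards [ae_cond_mem measurableSet_Icc] with x hx i
  rw [abs_le]
  constructor <;> linarith [hx.1 i, hx.2 i]

theorem Continuous.integrable_pi_uniformIcc {f : (Fin m → ℝ) → ℝ} (hf : Continuous f) :
    Integrable f (Measure.pi fun i => uniformIcc (φ i) r) := by
  rw [← cond_volume_Icc_eq_pi φ hr, ProbabilityTheory.cond]
  have h : (volume (Set.Icc (fun i => φ i - r) (fun i => φ i + r)))⁻¹ ≠ ⊤ := by
    rw [Real.volume_Icc_pi]
    simp only [add_sub_sub_cancel, Finset.prod_const]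
    refine ENNReal.inv_ne_top.2 (pow_ne_zero _ ?_)
    simp only [ne_eq, ENNReal.ofReal_eq_zero, not_le]
    linarith
  exact (hf.integrableOn_Icc).smul_measure h

theorem measurePreserving_reflect_pi_uniformIcc (j : Fin m) :
    MeasurePreserving (fun x : Fin m → ℝ => Function.update x j (2 * φ j - x j))
      (Measure.pi fun i => uniformIcc (φ i) r) (Measure.pi fun i => uniformIcc (φ i) r) := by
  have := fun i => isProbabilityMeasure_uniformIcc (φ i) hr
  have h := measurePreserving_pi (fun i => uniformIcc (φ i) r) (fun i => uniformIcc (φ i) r)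
    (f := fun i => if i = j then fun y => 2 * φ i - y else id) (fun i => by
      by_cases hi : i = j
      · simp only [hi, if_true]
        exact measurePreserving_reflect_uniformIcc _ _
      · simp only [hi, if_false]
        exact MeasurePreserving.id _)
  convert h using 2 with x
  ext i
  by_cases hi : i = j
  · subst hi
    simp
  · simp [hi]

/-- The reflection preserves the law; symmetrizing the integrand brings in second differences and
removes odd orders without any derivative of g. -/
theorem integral_pi_uniformIcc_eq_half {g : (Fin m → ℝ) → ℝ} (hg : Continuous g) (j : Fin m) :
    ∫ x, g x ∂(Measure.pi fun i => uniformIcc (φ i) r) =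
      ∫ x, (1 / 2) * (g x + g (Function.update x j (2 * φ j - x j)))
        ∂(Measure.pi fun i => uniformIcc (φ i) r) := by
  have hmp := measurePreserving_reflect_pi_uniformIcc φ hr j
  have h1 : ∫ x, g (Function.update x j (2 * φ j - x j))
      ∂(Measure.pi fun i => uniformIcc (φ i) r) =
      ∫ x, g x ∂(Measure.pi fun i => uniformIcc (φ i) r) := by
    conv_rhs => rw [← hmp.map_eq]
    rw [integral_map hmp.measurable.aemeasurable hg.aestronglyMeasurable]
  have hc : Continuous fun x : Fin m → ℝ => g (Function.update x j (2 * φ j - x j)) :=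
    hg.comp (continuous_id.update j (by fun_prop))
  rw [integral_const_mul, integral_add (hg.integrable_pi_uniformIcc φ hr)
    (hc.integrable_pi_uniformIcc φ hr), h1]
  ring

/-- Coordinates are released from the centre one at a time. Each release, symmetrized by a
reflection, lowers the mean by at most half of M_j r². -/
theorem integral_piecewise_ge {F : (Fin m → ℝ) → ℝ} (hF : Continuous F) {M : Fin m → ℝ}
    (hM : ∀ j, 0 ≤ M j)
    (h2 : ∀ θ j t, |F (Function.update θ j (θ j + t)) + F (Function.update θ j (θ j - t))
      - 2 * F θ| ≤ M j * t ^ 2) (s : Finset (Fin m)) :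
    F φ - r ^ 2 / 2 * ∑ j ∈ s, M j ≤
      ∫ x, F (s.piecewise x φ) ∂(Measure.pi fun i => uniformIcc (φ i) r) := by
  have := fun i => isProbabilityMeasure_uniformIcc (φ i) hr
  have hc : ∀ s : Finset (Fin m), Continuous fun x : Fin m → ℝ => F (s.piecewise x φ) := by
    intro s
    refine hF.comp (continuous_pi fun i => ?_)
    by_cases hi : i ∈ s
    · simpa [Finset.piecewise, hi] using continuous_apply i
    · simpa [Finset.piecewise, hi] using continuous_const
  induction s using Finset.induction_on with
  | empty => simp
  | insert j s hj ih =>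
    rw [Finset.sum_insert hj, integral_pi_uniformIcc_eq_half φ hr (hc _) j]
    have hle : ∫ x, (F (s.piecewise x φ) - r ^ 2 / 2 * M j)
        ∂(Measure.pi fun i => uniformIcc (φ i) r) ≤
        ∫ x, (1 / 2) * (F ((insert j s).piecewise x φ) +
          F ((insert j s).piecewise (Function.update x j (2 * φ j - x j)) φ))
          ∂(Measure.pi fun i => uniformIcc (φ i) r) := by
      refine integral_mono_ae (((hc s).sub continuous_const).integrable_pi_uniformIcc φ hr)
        (Continuous.integrable_pi_uniformIcc φ hr (continuous_const.mul ((hc _).add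
          ((hc (insert j s)).comp (continuous_id.update j (by fun_prop)))))) ?_
      filter_upwards [ae_abs_sub_le_pi_uniformIcc φ hr] with x hx
      have hy : s.piecewise x φ j = φ j := Finset.piecewise_eq_of_notMem _ _ _ hj
      have e1 : (insert j s).piecewise x φ =
          Function.update (s.piecewise x φ) j (s.piecewise x φ j + (x j - φ j)) := by
        rw [Finset.piecewise_insert, hy]
        congr 1
        ring
      have e2 : (insert j s).piecewise (Function.update x j (2 * φ j - x j)) φ =
          Function.update (s.piecewise x φ) j (s.piecewise x φ j - (x j - φ j)) := by
        rw [Finset.piecewise_insert, hy, Function.update_self]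
        have : s.piecewise (Function.update x j (2 * φ j - x j)) φ = s.piecewise x φ := by
          ext i
          by_cases hi : i ∈ s
          · have : i ≠ j := fun h => hj (h ▸ hi)
            simp [hi, this]
          · simp [hi]
        rw [this]
        congr 1
        ring
      have h3 := (abs_le.1 (h2 (s.piecewise x φ) j (x j - φ j))).1
      rw [← e1, ← e2] at h3
      have h4 : (x j - φ j) ^ 2 ≤ r ^ 2 := sq_le_sq' (by linarith [(abs_le.1 (hx j)).1])
        (abs_le.1 (hx j)).2
      have h5 := mul_le_mul_of_nonneg_left h4 (hM j)
      linarith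
    rw [integral_sub ((hc s).integrable_pi_uniformIcc φ hr) (integrable_const _),
      integral_const] at hle
    simp only [probReal_univ, one_smul] at hle
    linarith

/-- With coordinate p frozen, G depends only on the other coordinates, which are independent of x_p
under the product law. -/
theorem integral_mul_piecewise {w : ℝ → ℝ} (hw : Continuous w) {G : (Fin m → ℝ) → ℝ}
    (hG : Continuous G) (p : Fin m) :
    ∫ x, w (x p) * G ((Finset.univ.erase p).piecewise x φ)
      ∂(Measure.pi fun i => uniformIcc (φ i) r) =
      (∫ y, w y ∂uniformIcc (φ p) r) *
        ∫ x, G ((Finset.univ.erase p).piecewise x φ)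
          ∂(Measure.pi fun i => uniformIcc (φ i) r) := by
  have := fun i => isProbabilityMeasure_uniformIcc (φ i) hr
  have hind : iIndepFun (fun (i : Fin m) (x : Fin m → ℝ) => x i)
      (Measure.pi fun i => uniformIcc (φ i) r) :=
    iIndepFun_pi (μ := fun i => uniformIcc (φ i) r) (X := fun _ y => y)
      fun _ => measurable_id.aemeasurable
  have hdis : Disjoint ({p} : Finset (Fin m)) (Finset.univ.erase p) := by simp
  have h1 := hind.indepFun_finset {p} (Finset.univ.erase p) hdis fun i => measurable_pi_apply i
  set g1 : (↥({p} : Finset (Fin m)) → ℝ) → ℝ := fun v => w (v ⟨p, Finset.mem_singleton_self p⟩)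
  set g2 : (↥(Finset.univ.erase p) → ℝ) → ℝ := fun v =>
    G fun i => if h : i ∈ Finset.univ.erase p then v ⟨i, h⟩ else φ i
  have hg1 : Continuous g1 := hw.comp (continuous_apply _)
  have hg2 : Continuous g2 := by
    refine hG.comp (continuous_pi fun i => ?_)
    by_cases h : i ∈ Finset.univ.erase p
    · simp only [h, dite_true]
      exact continuous_apply _
    · simp only [h, dite_false]
      exact continuous_const
  have h2 := h1.comp hg1.measurable hg2.measurable
  have e2 : (g2 ∘ fun (a : Fin m → ℝ) (i : (Finset.univ.erase p : Finset (Fin m))) => a i) =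
      fun x => G ((Finset.univ.erase p).piecewise x φ) := by
    ext x
    simp only [g2, Function.comp, dite_eq_ite]
    rfl
  have e1 : (g1 ∘ fun (a : Fin m → ℝ) (i : ({p} : Finset (Fin m))) => a i) = fun x => w (x p) := rfl
  rw [e1, e2] at h2
  have h3 := h2.integral_mul_eq_mul_integral
    (hw.comp (continuous_apply p)).aestronglyMeasurable
    (by rw [← e2]; exact (hg2.comp (by fun_prop)).aestronglyMeasurable)
  simp only [Pi.mul_apply] at h3
  rw [h3]
  congr 1
  have hmp := measurePreserving_eval (fun i => uniformIcc (φ i) r) p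
  conv_rhs => rw [← hmp.map_eq]
  rw [integral_map hmp.measurable.aemeasurable hw.aestronglyMeasurable]

/-- The correlation of a function with the second Legendre polynomial of the coordinate `p`, for
a function whose second derivative `F` in the direction of `p` varies slowly. -/
theorem integral_quadratic_mul_ge {L F : (Fin m → ℝ) → ℝ} (hL : Continuous L) (hF : Continuous F)
    {M : Fin m → ℝ} (hM : ∀ j, 0 ≤ M j) {C : ℝ} (hC : 0 ≤ C) (p : Fin m)
    (h4 : ∀ θ t, |L (Function.update θ p (θ p + t)) + L (Function.update θ p (θ p - t))
      - 2 * L θ - t ^ 2 * F θ| ≤ C * t ^ 4)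
    (h2 : ∀ θ j t, |F (Function.update θ j (θ j + t)) + F (Function.update θ j (θ j - t))
      - 2 * F θ| ≤ M j * t ^ 2) :
    2 / 45 * r ^ 4 * (F φ - r ^ 2 / 2 * ∑ j ∈ Finset.univ.erase p, M j) - C * r ^ 6 / 2 ≤
      ∫ x, ((x p - φ p) ^ 2 - r ^ 2 / 3) * L x ∂(Measure.pi fun i => uniformIcc (φ i) r) := by
  have := fun i => isProbabilityMeasure_uniformIcc (φ i) hr
  set s : Finset (Fin m) := Finset.univ.erase p with hs
  have hps : p ∉ s := Finset.notMem_erase p _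
  have hcont : Continuous fun x : Fin m → ℝ => s.piecewise x φ := by
    refine continuous_pi fun i => ?_
    by_cases hi : i ∈ s
    · simpa [Finset.piecewise, hi] using continuous_apply i
    · simpa [Finset.piecewise, hi] using continuous_const
  have hw : Continuous fun y : ℝ => (y - φ p) ^ 2 - r ^ 2 / 3 := by fun_prop
  have hw2 : Continuous fun y : ℝ => ((y - φ p) ^ 2 - r ^ 2 / 3) * (y - φ p) ^ 2 := by fun_prop
  have i1 := integral_mul_piecewise φ hr hw hL p
  have i2 := integral_mul_piecewise φ hr hw2 hF p
  rw [integral_uniformIcc_quadratic _ hr, zero_mul] at i1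
  rw [integral_uniformIcc_quadratic_mul_sq _ hr] at i2
  have i3 := integral_piecewise_ge φ hr hF hM h2 s
  rw [← hs] at i1 i2
  have c1 : Continuous fun x : Fin m → ℝ => ((x p - φ p) ^ 2 - r ^ 2 / 3) * L (s.piecewise x φ) :=
    (by fun_prop : Continuous fun x : Fin m → ℝ => (x p - φ p) ^ 2 - r ^ 2 / 3).mul
      (hL.comp hcont)
  have c2 : Continuous fun x : Fin m → ℝ =>
      ((x p - φ p) ^ 2 - r ^ 2 / 3) * (x p - φ p) ^ 2 * F (s.piecewise x φ) :=
    (by fun_prop : Continuous fun x : Fin m → ℝ =>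
      ((x p - φ p) ^ 2 - r ^ 2 / 3) * (x p - φ p) ^ 2).mul (hF.comp hcont)
  have c3 : Continuous fun x : Fin m → ℝ => ((x p - φ p) ^ 2 - r ^ 2 / 3) * L x :=
    (by fun_prop : Continuous fun x : Fin m → ℝ => (x p - φ p) ^ 2 - r ^ 2 / 3).mul hL
  rw [integral_pi_uniformIcc_eq_half φ hr c3 p]
  -- The weight is even under the reflection of coordinate p, so the pair of loss values is replaced
  -- pointwise by its expansion about x_p = φ_p. The remainder costs ½ · r² · C r⁴, since the weight
  -- is at most r² in absolute value.
  have hle : ∫ x, (((x p - φ p) ^ 2 - r ^ 2 / 3) * L (s.piecewise x φ) +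
      1 / 2 * (((x p - φ p) ^ 2 - r ^ 2 / 3) * (x p - φ p) ^ 2 * F (s.piecewise x φ)) -
      C * r ^ 6 / 2) ∂(Measure.pi fun i => uniformIcc (φ i) r) ≤
      ∫ x, 1 / 2 * (((x p - φ p) ^ 2 - r ^ 2 / 3) * L x +
        (((Function.update x p (2 * φ p - x p)) p - φ p) ^ 2 - r ^ 2 / 3) *
          L (Function.update x p (2 * φ p - x p)))
        ∂(Measure.pi fun i => uniformIcc (φ i) r) := by
    refine integral_mono_ae (Continuous.integrable_pi_uniformIcc φ hr
        ((c1.add (continuous_const.mul c2)).sub continuous_const))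
      (Continuous.integrable_pi_uniformIcc φ hr (continuous_const.mul (c3.add
          (c3.comp (continuous_id.update p (by fun_prop)))))) ?_
    filter_upwards [ae_abs_sub_le_pi_uniformIcc φ hr] with x hx
    have hy : s.piecewise x φ p = φ p := Finset.piecewise_eq_of_notMem _ _ _ hps
    have hupd : ∀ y, Function.update (s.piecewise x φ) p y = Function.update x p y := by
      intro y
      ext i
      by_cases hi : i = p
      · subst hi
        simp
      · simp [hi, hs]
    have e1 : Function.update (s.piecewise x φ) p (s.piecewise x φ p + (x p - φ p)) = x := by
      rw [hupd, hy, add_sub_cancel, Function.update_eq_self]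
    have e2 : Function.update (s.piecewise x φ) p (s.piecewise x φ p - (x p - φ p)) =
        Function.update x p (2 * φ p - x p) := by
      rw [hupd, hy]
      congr 1
      ring
    have h3 := h4 (s.piecewise x φ) (x p - φ p)
    rw [e1, e2] at h3
    have hsq : (x p - φ p) ^ 2 ≤ r ^ 2 := sq_le_sq' (by linarith [(abs_le.1 (hx p)).1])
      (abs_le.1 (hx p)).2
    have hw1 : |(x p - φ p) ^ 2 - r ^ 2 / 3| ≤ r ^ 2 := by
      rw [abs_le]
      constructor <;> linarith [sq_nonneg (x p - φ p), sq_nonneg r]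
    have hfour : (x p - φ p) ^ 4 ≤ r ^ 4 := by
      have := mul_le_mul hsq hsq (sq_nonneg _) (sq_nonneg _)
      linarith
    have h5 := mul_le_mul hw1 (h3.trans (mul_le_mul_of_nonneg_left hfour hC)) (abs_nonneg _)
      (sq_nonneg _)
    rw [← abs_mul] at h5
    have h6 := (abs_le.1 h5).1
    have e3 : (Function.update x p (2 * φ p - x p)) p - φ p = -(x p - φ p) := by
      rw [Function.update_self]
      ring
    rw [e3, neg_sq]
    linarith
  refine le_trans ?_ hle
  have c4 : Continuous fun x : Fin m → ℝ =>
      ((x p - φ p) ^ 2 - r ^ 2 / 3) * L (s.piecewise x φ) +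
        1 / 2 * (((x p - φ p) ^ 2 - r ^ 2 / 3) * (x p - φ p) ^ 2 * F (s.piecewise x φ)) :=
    c1.add (continuous_const.mul c2)
  rw [integral_sub (c4.integrable_pi_uniformIcc φ hr)
    (integrable_const _), integral_add (c1.integrable_pi_uniformIcc φ hr)
    ((c2.integrable_pi_uniformIcc φ hr).const_mul _), integral_const_mul, integral_const, i1, i2]
  simp only [probReal_univ, one_smul]
  have h7 := mul_le_mul_of_nonneg_left i3 (by positivity : 0 ≤ 2 / 45 * r ^ 4)
  linarith

/-- Cauchy–Schwarz for the weight and the centred L; the mean of L drops out because the weight has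
mean zero. -/
theorem sq_integral_quadratic_mul_le {L : (Fin m → ℝ) → ℝ} (hL : Continuous L) (p : Fin m) :
    (∫ x, ((x p - φ p) ^ 2 - r ^ 2 / 3) * L x ∂(Measure.pi fun i => uniformIcc (φ i) r)) ^ 2 ≤
      4 / 45 * r ^ 4 * variance L (Measure.pi fun i => uniformIcc (φ i) r) := by
  have := fun i => isProbabilityMeasure_uniformIcc (φ i) hr
  set μ := Measure.pi fun i => uniformIcc (φ i) r with hμ
  set T := ∫ x, ((x p - φ p) ^ 2 - r ^ 2 / 3) * L x ∂μ with hT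
  set a := ∫ x, L x ∂μ with ha
  have hwc : Continuous fun y : ℝ => (y - φ p) ^ 2 - r ^ 2 / 3 := by fun_prop
  have hw0 := integral_mul_piecewise φ hr hwc (continuous_const (y := (1 : ℝ))) p
  simp only [mul_one] at hw0
  rw [integral_uniformIcc_quadratic _ hr, zero_mul, ← hμ] at hw0
  have hww := integral_mul_piecewise φ hr
    (by fun_prop : Continuous fun y : ℝ => ((y - φ p) ^ 2 - r ^ 2 / 3) * (y - φ p) ^ 2)
    (continuous_const (y := (1 : ℝ))) p
  simp only [mul_one, integral_const, probReal_univ, one_smul] at hww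
  rw [integral_uniformIcc_quadratic_mul_sq _ hr, ← hμ] at hww
  set w : (Fin m → ℝ) → ℝ := fun x => (x p - φ p) ^ 2 - r ^ 2 / 3 with hwdef
  have hw : Continuous w := by fun_prop
  have hw2 : ∫ x, w x ^ 2 ∂μ = 4 / 45 * r ^ 4 := by
    have e : ∀ x, w x ^ 2 = w x * (x p - φ p) ^ 2 - r ^ 2 / 3 * w x := fun x => by
      simp only [hwdef]
      ring
    simp only [e]
    rw [integral_sub (Continuous.integrable_pi_uniformIcc φ hr (by fun_prop))
      (Continuous.integrable_pi_uniformIcc φ hr (by fun_prop)), integral_const_mul]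
    simp only [hwdef]
    rw [hww, hw0]
    ring
  rw [variance_eq_integral hL.aemeasurable]
  have hpos : (0 : ℝ) < 4 / 45 * r ^ 4 := by positivity
  -- The coefficient of the orthogonal projection of L onto the weight, which minimizes the
  -- integrated square below.
  set lam := T / (4 / 45 * r ^ 4) with hlam
  have key : 0 ≤ ∫ x, ((L x - a) - lam * w x) ^ 2 ∂μ := integral_nonneg fun x => sq_nonneg _
  have e : ∀ x, ((L x - a) - lam * w x) ^ 2 =
      (L x - a) ^ 2 - 2 * lam * (w x * L x) + 2 * lam * a * w x + lam ^ 2 * w x ^ 2 :=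
    fun x => by ring
  simp only [e] at key
  rw [integral_add (Continuous.integrable_pi_uniformIcc φ hr (by fun_prop))
      (Continuous.integrable_pi_uniformIcc φ hr (by fun_prop)),
    integral_add (Continuous.integrable_pi_uniformIcc φ hr (by fun_prop))
      (Continuous.integrable_pi_uniformIcc φ hr (by fun_prop)),
    integral_sub (Continuous.integrable_pi_uniformIcc φ hr (by fun_prop))
      (Continuous.integrable_pi_uniformIcc φ hr (by fun_prop)),
    integral_const_mul, integral_const_mul, integral_const_mul, hw2, hw0, ← hT] at key
  have h1 : lam * (4 / 45 * r ^ 4) = T := by rw [hlam]; field_simp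
  set V := ∫ x, (L x - a) ^ 2 ∂μ
  have h2 : lam ^ 2 * (4 / 45 * r ^ 4) = lam * T := by rw [sq, mul_assoc, h1]
  have h3 : lam * T ≤ V := by linarith
  calc T ^ 2 = 4 / 45 * r ^ 4 * (lam * T) := by rw [← mul_assoc, mul_comm (_ * _) lam, h1, sq]
    _ ≤ _ := mul_le_mul_of_nonneg_left h3 hpos.le

end Box

/-! ### The variance bound from the curvature. -/

namespace VarProblem

variable {n m K : ℕ} (P : VarProblem n m K)

/-- The variance of the loss around a point where it curves upwards in the direction of the last
parameter. -/
theorem patchVar_ge (hunc : ∀ l, P.S l = P.lastParam → l = Fin.last K) {θ : Fin m → ℝ} {B r : ℝ}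
    (hB : 0 < B) (hcurv : 2 * B ≤ P.lossCurv θ)
    (hBle : 2 * B ≤ ‖P.O‖ * P.maxFreq P.lastParam ^ 2) (hr : 0 < r)
    (hrB : r ^ 2 * (128 * ‖P.O‖ ^ 2 * P.maxFreq P.lastParam ^ 4 *
      max (∑ j ∈ Finset.univ.erase P.lastParam, P.maxFreq j ^ 2)
        (P.maxFreq P.lastParam ^ 2 / 2)) ≤ 9 * B ^ 2) :
    B ^ 2 / 18 * r ^ 4 ≤ P.patchVar θ r := by
  have hω := P.maxFreq_lastParam hunc
  set ω := P.maxFreq P.lastParam with hωdef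
  set S := ∑ j ∈ Finset.univ.erase P.lastParam, P.maxFreq j ^ 2 with hS
  set o := ‖P.O‖ with ho
  have ho0 : 0 ≤ o := norm_nonneg _
  have key := integral_quadratic_mul_ge θ hr P.continuous_loss P.continuous_lossCurv
    (M := fun j => o * ω ^ 2 * P.maxFreq j ^ 2) (fun j => by positivity)
    (C := o * ω ^ 4 / 12) (by positivity) P.lastParam
    (fun φ t => by rw [hω]; exact P.abs_loss_add_loss_sub_le hunc φ t)
    (fun φ j t => by rw [hω]; exact P.abs_lossCurv_second_difference_le φ j t)
  have hvar := sq_integral_quadratic_mul_le θ hr P.continuous_loss P.lastParam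
  rw [← cond_volume_Icc_eq_pi θ hr] at key hvar
  rw [← Finset.mul_sum, ← hS] at key
  rw [patchVar]
  set V := variance P.loss
    (cond (volume : Measure (Fin m → ℝ)) (Set.Icc (fun i => θ i - r) (fun i => θ i + r)))
  set T := ∫ x, ((x P.lastParam - θ P.lastParam) ^ 2 - r ^ 2 / 3) * P.loss x
    ∂(cond (volume : Measure (Fin m → ℝ)) (Set.Icc (fun i => θ i - r) (fun i => θ i + r)))
  set x := o * ω ^ 2 with hx
  have hx0 : 0 < x := by linarith
  -- One factor B of the radius condition is traded for x/2 by 2B ≤ x. The entry S of the maximum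
  -- controls the drift of the curvature, and ω²/2 controls the quartic remainder.
  have bound : ∀ y, y ≤ max S (ω ^ 2 / 2) → r ^ 2 * x * y ≤ 9 / 256 * B := by
    intro y hy
    have h1 : r ^ 2 * (128 * x ^ 2 * y) ≤ 9 * B ^ 2 := by
      refine le_trans ?_ hrB
      have e : 128 * o ^ 2 * ω ^ 4 = 128 * x ^ 2 := by rw [hx]; ring
      rw [e]
      gcongr
    have h2 : 128 * x * (r ^ 2 * x * y) ≤ 128 * x * (9 / 256 * B) := by nlinarith
    exact le_of_mul_le_mul_left h2 (by positivity)
  have b1 := bound S (le_max_left _ _)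
  have b2 := bound _ (le_max_right S (ω ^ 2 / 2))
  have hr4 : 0 < r ^ 4 := by positivity
  -- The coefficient obtained is (2/45)(2 − 9/512) − 9/(256 · 12), about 0.085. Rounded down to 2/25
  -- it gives (2/25)² · 45/4 = 0.072, above the required 1/18.
  have hT : 2 / 25 * B * r ^ 4 ≤ T := by
    refine le_trans ?_ key
    have e1 : o * ω ^ 4 / 12 * r ^ 6 / 2 = r ^ 4 * ((r ^ 2 * x * (ω ^ 2 / 2)) / 12) := by
      rw [hx]
      ring
    have e2 : r ^ 4 * ((r ^ 2 * x * (ω ^ 2 / 2)) / 12) ≤ r ^ 4 * ((9 / 256 * B) / 12) := by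
      gcongr
    have e3 : 2 / 45 * r ^ 4 * (2 * B - (9 / 256 * B) / 2) ≤
        2 / 45 * r ^ 4 * (P.lossCurv θ - r ^ 2 / 2 * (x * S)) := by
      gcongr
      linarith
    rw [e1]
    nlinarith [mul_pos hB hr4]
  have h3 : (2 / 25 * B * r ^ 4) ^ 2 ≤ 4 / 45 * r ^ 4 * V :=
    le_trans (pow_le_pow_left₀ (by positivity) hT 2) hvar
  have h4 : r ^ 4 * ((2 / 25 * B) ^ 2 * r ^ 4) ≤ r ^ 4 * (4 / 45 * V) := by
    linarith
  have h5 := le_of_mul_le_mul_left h4 hr4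
  nlinarith [mul_nonneg (sq_nonneg B) hr4.le]

theorem stateVar_le : P.stateVar ≤ P.gateFreq (Fin.last K) ^ 2 / 4 := by
  obtain ⟨c, hc⟩ := (P.H_herm (Fin.last K)).exists_norm_sub_smul_one_le
  have h := P.ρ_psd.variance_le P.ρ_trace (P.H_herm (Fin.last K)) hc
  rw [stateVar]
  refine h.trans (le_of_eq ?_)
  rw [gateFreq]
  ring

theorem maxFreq_le_iSup (q : Fin m) : P.maxFreq q ≤ ⨆ q, P.maxFreq q :=
  le_ciSup (Set.finite_range _).bddAbove q

theorem max_sum_maxFreq_sq_le :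
    max (∑ j ∈ Finset.univ.erase P.lastParam, P.maxFreq j ^ 2)
        (P.maxFreq P.lastParam ^ 2 / 2) ≤ m * (⨆ q, P.maxFreq q) ^ 2 := by
  have h : ∀ q, P.maxFreq q ^ 2 ≤ (⨆ q, P.maxFreq q) ^ 2 := fun q =>
    pow_le_pow_left₀ (P.maxFreq_nonneg q) (P.maxFreq_le_iSup q) 2
  have hsum : ∑ j, P.maxFreq j ^ 2 ≤ m * (⨆ q, P.maxFreq q) ^ 2 := by
    refine (Finset.sum_le_card_nsmul _ _ _ fun q _ => h q).trans (le_of_eq ?_)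
    simp
  have hle : ∀ s : Finset (Fin m), ∑ j ∈ s, P.maxFreq j ^ 2 ≤ ∑ j, P.maxFreq j ^ 2 := fun s =>
    Finset.sum_le_sum_of_subset_of_nonneg (Finset.subset_univ s) fun _ _ _ => sq_nonneg _
  refine (max_le (hle _) ?_).trans hsum
  have := hle {P.lastParam}
  rw [Finset.sum_singleton] at this
  nlinarith [sq_nonneg (P.maxFreq P.lastParam)]

variable {P}

/-! ### Positivity, curvature and admissible radii at a good minimum. -/

namespace GoodMinimum

variable {E : EigenDecomp P.O} {θ : Fin m → ℝ} {ε : ℂ} (h : P.GoodMinimum E θ ε)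
include h

theorem gap_pos : 0 < E.gap := sub_pos.2 h.nondeg

theorem norm_pos : 0 < ‖P.O‖ := by
  have := h.gap_pos
  have := E.gap_le
  linarith

theorem denom_pos : 0 < (6 * ‖P.O‖ + 11 * E.gap) * ‖P.lastH‖ ^ 2 := by
  have hg := h.gap_pos
  have ho := h.norm_pos
  have ht := (norm_nonneg ε).trans_lt h.small
  rw [threshold] at ht
  -- A vanishing denominator would make the threshold 0, by the convention x / 0 = 0, and no ‖ε‖
  -- lies below 0.
  refine lt_of_le_of_ne (by positivity) fun e => ?_
  rw [← e, div_zero] at ht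
  exact lt_irrefl _ ht

theorem norm_mul_lt :
    ‖ε‖ * ((6 * ‖P.O‖ + 11 * E.gap) * ‖P.lastH‖ ^ 2) < E.gap * P.stateVar := by
  have := h.small
  rwa [threshold, lt_div_iff₀ h.denom_pos] at this

theorem curv_pos : 0 < P.curv E ε := by
  have := h.norm_mul_lt
  rw [curv]
  linarith

theorem stateVar_pos : 0 < P.stateVar := by
  have h1 := h.norm_mul_lt
  have h2 := mul_nonneg (norm_nonneg ε) h.denom_pos.le
  exact pos_of_mul_pos_right (h2.trans_lt h1) h.gap_pos.le

theorem maxFreq_lastParam : P.maxFreq P.lastParam = P.gateFreq (Fin.last K) :=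
  P.maxFreq_lastParam h.uncorrelated

/-- The gap is at most 2‖O‖ and the variance at most a quarter of the squared spread. This supplies
the comparison of B with ‖O‖ω_p² needed in `patchVar_ge`. -/
theorem two_mul_gap_mul_stateVar_le :
    2 * (E.gap * P.stateVar) ≤ ‖P.O‖ * P.maxFreq P.lastParam ^ 2 := by
  rw [h.maxFreq_lastParam]
  have h1 := mul_le_mul E.gap_le P.stateVar_le h.stateVar_pos.le (by positivity)
  linarith

theorem maxFreq_pos : 0 < P.maxFreq P.lastParam := by
  refine lt_of_le_of_ne (P.maxFreq_nonneg _) fun e => ?_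
  have h1 := h.two_mul_gap_mul_stateVar_le
  rw [← e] at h1
  have := mul_pos h.gap_pos h.stateVar_pos
  simp only [ne_eq, OfNat.ofNat_ne_zero, not_false_eq_true, zero_pow, mul_zero] at h1
  linarith

theorem rStar_denom_pos : 0 < 128 * ‖P.O‖ ^ 2 * P.maxFreq P.lastParam ^ 4 *
    max (∑ j ∈ Finset.univ.erase P.lastParam, P.maxFreq j ^ 2)
      (P.maxFreq P.lastParam ^ 2 / 2) := by
  have h1 := h.norm_pos
  have h2 := h.maxFreq_pos
  have h3 : 0 < max (∑ j ∈ Finset.univ.erase P.lastParam, P.maxFreq j ^ 2)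
      (P.maxFreq P.lastParam ^ 2 / 2) := lt_max_of_lt_right (by positivity)
  positivity

theorem rStar_pos : 0 < P.rStar E ε := by
  have h1 := h.rStar_denom_pos
  have h2 := h.curv_pos
  rw [rStar]
  positivity

theorem two_mul_le_lossCurv :
    2 * (E.gap * P.stateVar - ‖ε‖ * ‖P.lastH‖ ^ 2 * (8 * E.gap + 2 * ‖P.O‖)) ≤ P.lossCurv θ :=
  P.lossCurv_ge E θ (norm_nonneg ε) h.nondeg h.fidelity

theorem curv_le : P.curv E ε ≤ E.gap * P.stateVar := by
  have := mul_nonneg (norm_nonneg ε) h.denom_pos.le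
  rw [curv]
  linarith

theorem two_mul_curv_le_lossCurv : 2 * P.curv E ε ≤ P.lossCurv θ := by
  refine le_trans ?_ h.two_mul_le_lossCurv
  have h1 := mul_nonneg (norm_nonneg ε) (sq_nonneg ‖P.lastH‖)
  rw [curv]
  nlinarith [mul_nonneg h1 h.gap_pos.le, mul_nonneg h1 h.norm_pos.le]

/-- The curvature at a good minimum, without reference to the distance of the infidelity from its
threshold. -/
theorem two_mul_gap_mul_stateVar_le_lossCurv :
    2 * (3 / 11 * (E.gap * P.stateVar)) ≤ P.lossCurv θ := by
  refine le_trans ?_ h.two_mul_le_lossCurv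
  have h1 := mul_nonneg (norm_nonneg ε) (sq_nonneg ‖P.lastH‖)
  -- Since 8g + 2‖O‖ ≤ (8/11)(11g + 6‖O‖), the loss of curvature is at most 8/11 of gap · Var, and
  -- 3/11 survives however close ‖ε‖ is to the threshold.
  nlinarith [mul_nonneg h1 h.gap_pos.le, mul_nonneg h1 h.norm_pos.le, h.norm_mul_lt]

theorem patchVar_ge_of_le_rStar {r : ℝ} (hr : 0 < r) (hr' : r ≤ P.rStar E ε) :
    P.curv E ε ^ 2 / 18 * r ^ 4 ≤ P.patchVar θ r := by
  refine P.patchVar_ge h.uncorrelated h.curv_pos h.two_mul_curv_le_lossCurv ?_ hr ?_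
  · linarith [h.two_mul_gap_mul_stateVar_le, h.curv_le]
  · rw [rStar, Real.le_sqrt' hr, le_div_iff₀ h.rStar_denom_pos] at hr'
    exact hr'

omit h in
theorem rStar_denom_le : 128 * ‖P.O‖ ^ 2 * P.maxFreq P.lastParam ^ 4 *
    max (∑ j ∈ Finset.univ.erase P.lastParam, P.maxFreq j ^ 2)
      (P.maxFreq P.lastParam ^ 2 / 2) ≤ 128 * ‖P.O‖ ^ 2 * (⨆ q, P.maxFreq q) ^ 6 * m := by
  have h1 := P.max_sum_maxFreq_sq_le
  have h2 := pow_le_pow_left₀ (P.maxFreq_nonneg _) (P.maxFreq_le_iSup P.lastParam) 4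
  calc _ ≤ 128 * ‖P.O‖ ^ 2 * (⨆ q, P.maxFreq q) ^ 4 * (m * (⨆ q, P.maxFreq q) ^ 2) := by
        have h3 : 0 ≤ max (∑ j ∈ Finset.univ.erase P.lastParam, P.maxFreq j ^ 2)
          (P.maxFreq P.lastParam ^ 2 / 2) := le_max_of_le_right (by positivity)
        gcongr
    _ = _ := by ring

theorem patchVar_ge_of_sq_le {r : ℝ} (hr : 0 < r)
    (hr' : r ^ 2 * (128 * ‖P.O‖ ^ 2 * (⨆ q, P.maxFreq q) ^ 6 * m) ≤
      9 * (3 / 11 * (E.gap * P.stateVar)) ^ 2) :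
    (3 / 11 * (E.gap * P.stateVar)) ^ 2 / 18 * r ^ 4 ≤ P.patchVar θ r := by
  have h1 := mul_pos h.gap_pos h.stateVar_pos
  refine P.patchVar_ge h.uncorrelated (by positivity) h.two_mul_gap_mul_stateVar_le_lossCurv ?_ hr
    (le_trans ?_ hr')
  · linarith [h.two_mul_gap_mul_stateVar_le]
  · exact mul_le_mul_of_nonneg_left rStar_denom_le (sq_nonneg r)

theorem mul_le_curv {δ : ℝ} (hε : ‖ε‖ ≤ (1 - δ) * P.threshold E) :
    δ * (E.gap * P.stateVar) ≤ P.curv E ε := by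
  rw [threshold, ← mul_div_assoc, le_div_iff₀ h.denom_pos] at hε
  rw [curv]
  linarith

theorem le_rStar {r : ℝ} (hr : 0 < r)
    (hr' : r ^ 2 * (128 * ‖P.O‖ ^ 2 * (⨆ q, P.maxFreq q) ^ 6 * m) ≤ 9 * P.curv E ε ^ 2) :
    r ≤ P.rStar E ε := by
  rw [rStar, Real.le_sqrt' hr, le_div_iff₀ h.rStar_denom_pos]
  exact (mul_le_mul_of_nonneg_left rStar_denom_le (sq_nonneg r)).trans hr'

end GoodMinimum

end VarProblem

/-! ### Polynomial rates and the conclusion. -/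

/-- The radius is chosen so that 4 r o W³ √m ≤ B. Squaring and multiplying by 8 gives the factor 128
with 8B² on the right. -/
theorem sq_mul_le_of_rate {N m b c₁ c₂ B o W : ℝ} {s k₁ k₂ : ℕ} (hN : 1 ≤ N) (hm : 1 ≤ m)
    (hb : 0 < b) (hc₁ : 0 < c₁) (hc₂ : 0 < c₂) (hB : b / N ^ s ≤ B) (ho : 0 ≤ o)
    (ho' : o ≤ c₁ * N ^ k₁) (hW : 0 ≤ W) (hW' : W ≤ c₂ * N ^ k₂) :
    (b / (4 * c₁ * c₂ ^ 3) / (√m * N ^ (s + k₁ + 3 * k₂))) ^ 2 * (128 * o ^ 2 * W ^ 6 * m) ≤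
      9 * B ^ 2 := by
  have hN0 : 0 < N := by linarith
  have hm0 : 0 < √m := Real.sqrt_pos.2 (by linarith)
  set r := b / (4 * c₁ * c₂ ^ 3) / (√m * N ^ (s + k₁ + 3 * k₂)) with hr
  have hr0 : 0 < r := by positivity
  have h1 : r * (4 * (o * W ^ 3) * √m) ≤ B := by
    calc r * (4 * (o * W ^ 3) * √m) ≤ r * (4 * ((c₁ * N ^ k₁) * (c₂ * N ^ k₂) ^ 3) * √m) := by
          gcongr
      _ = b / N ^ s := by
          rw [hr]
          field_simp
          ring
      _ ≤ B := hB
  have h2 := pow_le_pow_left₀ (by positivity) h1 2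
  have h3 : (r * (4 * (o * W ^ 3) * √m)) ^ 2 * 8 = r ^ 2 * (128 * o ^ 2 * W ^ 6 * m) := by
    have : √m ^ 2 = m := Real.sq_sqrt (by linarith)
    rw [mul_pow, mul_pow, this]
    ring
  rw [← h3]
  nlinarith [sq_nonneg B]

/-- The fourth power of the radius decays as m⁻². The polynomial bound on m absorbs this factor, and
the single √m is afforded by √m ≥ 1. -/
theorem le_of_variance_rate {N m a b c B r V : ℝ} {s k l : ℕ} (hN : 1 ≤ N) (hm : 1 ≤ m)
    (ha : 0 < a) (hb : 0 < b) (hB : b / N ^ s ≤ B) (hr : a / (√m * N ^ k) ≤ r)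
    (hmc : m ≤ c * N ^ l) (hV : B ^ 2 / 18 * r ^ 4 ≤ V) :
    b ^ 2 * a ^ 4 / (18 * c ^ 2) / (√m * N ^ (2 * s + 4 * k + 2 * l)) ≤ V := by
  have hN0 : 0 < N := by linarith
  have hm1 : 1 ≤ √m := Real.one_le_sqrt.2 hm
  have hm0 : 0 < √m := by linarith
  have hm2 : √m ^ 2 = m := Real.sq_sqrt (by linarith)
  calc b ^ 2 * a ^ 4 / (18 * c ^ 2) / (√m * N ^ (2 * s + 4 * k + 2 * l)) =
        b ^ 2 * a ^ 4 / (18 * (√m * (c * N ^ l) ^ 2) * (N ^ s) ^ 2 * (N ^ k) ^ 4) := by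
          rw [div_div]
          congr 1
          ring
    _ ≤ b ^ 2 * a ^ 4 / (18 * (1 * m ^ 2) * (N ^ s) ^ 2 * (N ^ k) ^ 4) := by
          have : 0 < m := by linarith
          gcongr
    _ = (b / N ^ s) ^ 2 / 18 * (a / (√m * N ^ k)) ^ 4 := by
          have e : √m ^ 4 = m ^ 2 := by rw [show 4 = 2 * 2 from rfl, pow_mul, hm2]
          rw [div_pow, div_pow, mul_pow, e]
          field_simp
    _ ≤ B ^ 2 / 18 * r ^ 4 := by gcongr
    _ ≤ V := hV

theorem corollary1 :
    -- the variance bound on the explicit patch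
    (∀ (n m K : ℕ) (P : VarProblem n m K) (E : EigenDecomp P.O) (θ : Fin m → ℝ) (ε : ℂ),
      P.GoodMinimum E θ ε →
        0 < P.curv E ε ∧ 0 < P.rStar E ε ∧
        ∀ r : ℝ, 0 < r → r ≤ P.rStar E ε →
          P.curv E ε ^ 2 / 18 * r ^ 4 ≤ P.patchVar θ r) ∧
    -- the scaling with the number of qubits
    (∀ (m K : ℕ → ℕ) (P : ∀ n, VarProblem n (m n) (K n)) (E : ∀ n, EigenDecomp (P n).O)
      (θ : ∀ n, Fin (m n) → ℝ) (ε : ℕ → ℂ),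
      (∀ᶠ n in Filter.atTop, (P n).GoodMinimum (E n) (θ n) (ε n)) →
      InOmegaInvPoly (fun _ => 1) (fun n => (E n).gap) →
      InOmegaInvPoly (fun _ => 1) (fun n => (P n).stateVar) →
      InOPoly (fun n => ‖(P n).O‖) →
      InOPoly (fun n => ⨆ q, (P n).maxFreq q) →
        -- some patch of half-width of exact order `1 / (√m poly(n))`
        (∃ a : ℝ, 0 < a ∧ ∃ k : ℕ,
          InOPoly (fun n => (m n : ℝ)) →
            InOmegaInvPoly (fun n => √(m n : ℝ))
              (fun n => (P n).patchVar (θ n) (a / (√(m n : ℝ) * (n : ℝ) ^ k)))) ∧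
        -- the explicit patch, if `|ε|` is below the threshold by an inverse polynomial factor
        (∀ δ : ℕ → ℝ, InOmegaInvPoly (fun _ => 1) δ →
          (∀ᶠ n in Filter.atTop, ‖ε n‖ ≤ (1 - δ n) * (P n).threshold (E n)) →
            InOmegaInvPoly (fun n => √(m n : ℝ)) (fun n => (P n).rStar (E n) (ε n)) ∧
            (InOPoly (fun n => (m n : ℝ)) →
              InOmegaInvPoly (fun n => √(m n : ℝ))
                (fun n => (P n).patchVar (θ n) ((P n).rStar (E n) (ε n)))))) := by
  refine ⟨fun n m K P E θ ε h => ⟨h.curv_pos, h.rStar_pos, fun r hr hr' =>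
    h.patchVar_ge_of_le_rStar hr hr'⟩, ?_⟩
  rintro m K P E θ ε hgood ⟨cg, hcg, kg, hgap⟩ ⟨cv, hcv, kv, hvar⟩ ⟨co, hco, ko, hO⟩
    ⟨cw, hcw, kw, hW⟩
  simp only [one_mul] at hgap hvar
  -- The parameter of the last gate is an element of `Fin (m n)`, so there is at least one
  -- parameter.
  have hm : ∀ n, (1 : ℝ) ≤ m n := fun n => by
    exact_mod_cast Nat.succ_le_of_lt (Fin.pos (P n).lastParam)
  have hW0 : ∀ n, 0 ≤ ⨆ q, (P n).maxFreq q := fun n =>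
    ((P n).maxFreq_nonneg _).trans ((P n).maxFreq_le_iSup (P n).lastParam)
  have hprod : ∀ᶠ n : ℕ in atTop,
      cg * cv / (n : ℝ) ^ (kg + kv) ≤ (E n).gap * (P n).stateVar := by
    filter_upwards [hgap, hvar] with n h1 h2
    rw [pow_add, mul_div_mul_comm]
    exact mul_le_mul h1 h2 (by positivity) (le_trans (by positivity) h1)
  constructor
  -- Using the surviving fraction 3/11 instead of `curv` makes this radius independent of the margin
  -- below the threshold.
  · set b := 3 / 11 * (cg * cv) with hb
    have hb0 : 0 < b := by positivity
    set a := b / (4 * co * cw ^ 3) with ha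
    have ha0 : 0 < a := by positivity
    refine ⟨a, ha0, kg + kv + ko + 3 * kw, ?_⟩
    rintro ⟨cm, hcm, km, hmle⟩
    refine ⟨b ^ 2 * a ^ 4 / (18 * cm ^ 2), by positivity,
      2 * (kg + kv) + 4 * (kg + kv + ko + 3 * kw) + 2 * km, ?_⟩
    filter_upwards [hgood, hprod, hO, hW, hmle, eventually_ge_atTop 1] with n h h1 h2 h3 h4 h5
    have hn : (1 : ℝ) ≤ n := by exact_mod_cast h5
    have hB : b / (n : ℝ) ^ (kg + kv) ≤ 3 / 11 * ((E n).gap * (P n).stateVar) := by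
      rw [hb, mul_div_assoc]
      gcongr
    refine le_of_variance_rate hn (hm n) ha0 hb0 hB le_rfl h4
      (h.patchVar_ge_of_sq_le ?_ (sq_mul_le_of_rate hn (hm n) hb0 hco hcw hB (norm_nonneg _) h2
        (hW0 n) h3))
    have := Real.sqrt_pos.2 (lt_of_lt_of_le one_pos (hm n))
    positivity
  · rintro δ ⟨cd, hcd, kd, hδ⟩ hε
    simp only [one_mul] at hδ
    set b := cd * (cg * cv) with hb
    have hb0 : 0 < b := by positivity
    set a := b / (4 * co * cw ^ 3) with ha
    have ha0 : 0 < a := by positivity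
    -- The explicit radius contains `curv`, which can vanish at the threshold; the margin δ keeps it
    -- at least δ · gap · Var.
    have hB : ∀ᶠ n : ℕ in atTop, b / (n : ℝ) ^ (kd + (kg + kv)) ≤ (P n).curv (E n) (ε n) := by
      filter_upwards [hgood, hprod, hδ, hε] with n h h1 h2 h3
      refine le_trans ?_ (h.mul_le_curv h3)
      rw [pow_add, hb, mul_div_mul_comm]
      exact mul_le_mul h2 h1 (by positivity) (le_trans (by positivity) h2)
    have hr : ∀ᶠ n : ℕ in atTop, a / (√(m n : ℝ) * (n : ℝ) ^ (kd + (kg + kv) + ko + 3 * kw)) ≤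
        (P n).rStar (E n) (ε n) := by
      filter_upwards [hgood, hB, hO, hW, eventually_ge_atTop 1] with n h h1 h2 h3 h5
      have hn : (1 : ℝ) ≤ n := by exact_mod_cast h5
      refine h.le_rStar ?_ (sq_mul_le_of_rate hn (hm n) hb0 hco hcw h1 (norm_nonneg _) h2
        (hW0 n) h3)
      have := Real.sqrt_pos.2 (lt_of_lt_of_le one_pos (hm n))
      positivity
    refine ⟨⟨a, ha0, _, hr⟩, ?_⟩
    rintro ⟨cm, hcm, km, hmle⟩
    refine ⟨b ^ 2 * a ^ 4 / (18 * cm ^ 2), by positivity,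
      2 * (kd + (kg + kv)) + 4 * (kd + (kg + kv) + ko + 3 * kw) + 2 * km, ?_⟩
    filter_upwards [hgood, hB, hr, hmle, eventually_ge_atTop 1] with n h h1 h2 h4 h5
    have hn : (1 : ℝ) ≤ n := by exact_mod_cast h5
    exact le_of_variance_rate hn (hm n) ha0 hb0 h1 h2 h4
      (h.patchVar_ge_of_le_rStar h.rStar_pos le_rfl)
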